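/- Theorem B. A complex algebra is a complex vector space with a bilinear product. It is \emph{bicommutative} if $(xy)z=(xz)y$ and $x(yz)=y(xz)$ for all $x,y,z$; it is \emph{nilpotent} if for some $n\ge 1$ every product of $n$ elements, with any bracketing, is zero; it is \emph{one-generated} if it is generated, as an algebra, by a single element. Let $\mathcal B$ be a $6$-dimensional complex one-generated nilpotent bicommutative algebra. Then $\mathcal B$ is isomorphic to an algebra from the following list. Each of these algebras is given in a basis $e_1,\dots,e_6$ by its nonzero products of basis vectors (a product that is not shown is zero), and the parameters $\lambda,\mu$ run over $\mathbb C$, with the restriction $\lambda\ne 0$ where indicated. - $B^6_{01}$: $e_1e_1=e_2, e_1e_2=e_4, e_1e_4=e_5, e_2e_1=e_3, e_3e_1=e_6$; - $B^6_{02}(\lambda)$: $e_1e_1=e_2, e_1e_2=e_4, e_1e_3=e_6, e_1e_4=e_5, e_2e_1=e_3, e_2e_2=e_6, e_3e_1=\lambda e_6, e_4e_1=e_6$; - $B^6_{03}(\lambda,\mu)$: $e_1e_1=e_2, e_1e_2=e_4, e_1e_3=e_6, e_1e_4=\lambda e_5+\mu e_6, e_2e_1=e_3, e_2e_2=e_6,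 e_3e_1=e_5, e_4e_1=e_6$; - $B^6_{04}$: $e_1e_1=e_2, e_1e_2=e_4, e_1e_3=e_6, e_2e_1=e_3, e_2e_2=e_6, e_3e_1=e_4+e_5, e_4e_1=e_6$; - $B^6_{05}$: $e_1e_1=e_2, e_1e_2=e_5, e_2e_1=e_3, e_3e_1=e_4, e_4e_1=e_6$; - $B^6_{06}$: $e_1e_1=e_2, e_1e_2=e_3, e_1e_3=e_4, e_1e_4=e_6, e_2e_1=e_4+e_5, e_2e_2=e_6, e_3e_1=e_6$; - $B^6_{07}$: $e_1e_1=e_2, e_1e_2=e_3, e_1e_3=e_4, e_1e_4=e_6, e_2e_1=e_3+e_4+e_5, e_2e_2=e_4+e_6, e_2e_3=e_6, e_3e_1=e_4+e_6, e_3e_2=e_6, e_4e_1=e_6$; - $B^6_{08}(\lambda)$: $e_1e_1=e_2, e_1e_2=e_3, e_1e_3=e_4, e_1e_4=e_6, e_2e_1=\lambda e_3+e_5, e_2e_2=\lambda e_4, e_2e_3=\lambda e_6, e_3e_1=\lambda e_4, e_3e_2=\lambda e_6, e_4e_1=\lambda e_6$; - $B^6_{09}(\lambda)$: $e_1e_1=e_2,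 e_1e_2=e_4, e_1e_3=e_6, e_1e_4=\lambda e_6, e_2e_1=e_3, e_2e_2=e_6, e_3e_1=e_5, e_4e_1=e_6, e_5e_1=e_6$; - $B^6_{10}$: $e_1e_1=e_2, e_1e_2=e_4, e_1e_4=e_6, e_2e_1=e_3, e_3e_1=e_5, e_5e_1=e_6$; - $B^6_{11}$: $e_1e_1=e_2, e_1e_2=e_4, e_2e_1=e_3, e_3e_1=e_5, e_5e_1=e_6$; - $B^6_{12}(\lambda)$: $e_1e_1=e_2, e_1e_2=e_3, e_1e_3=e_5, e_1e_5=e_6, e_2e_1=\lambda e_3+e_4, e_2e_2=\lambda e_5, e_2e_3=\lambda e_6, e_3e_1=\lambda e_5, e_3e_2=\lambda e_6, e_5e_1=\lambda e_6$; - $B^6_{13}(\lambda)$: $e_1e_1=e_2, e_1e_2=e_3, e_1e_3=e_5, e_1e_5=e_6, e_2e_1=\lambda e_3+e_4, e_2e_2=\lambda e_5, e_2e_3=\lambda e_6, e_3e_1=\lambda e_5, e_3e_2=\lambda e_6, e_4e_1=e_6, e_5e_1=\lambda e_6$; - $B^6_{14}(\lambda)$: $e_1e_1=e_2, e_1e_2=e_3,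 e_1e_3=e_5, e_1e_4=e_6, e_1e_5=e_6, e_2e_1=e_4, e_2e_2=e_6, e_3e_1=e_6, e_4e_1=\lambda e_6$; - $B^6_{15}(\lambda)$: $e_1e_1=e_2, e_1e_2=e_3, e_1e_3=e_5, e_1e_4=e_6, e_1e_5=e_6, e_2e_1=e_3+e_4, e_2e_2=e_5+e_6, e_2e_3=e_6, e_3e_1=e_5+e_6, e_3e_2=e_6, e_4e_1=\lambda e_6, e_5e_1=e_6$; - $B^6_{16}(\lambda)$ ($\lambda\neq 0$): $e_1e_1=e_2, e_1e_2=e_4, e_1e_3=e_5, e_1e_4=\lambda e_5, e_1e_5=\lambda e_6, e_2e_1=e_3, e_2e_2=e_5, e_2e_3=e_6, e_2e_4=\lambda e_6, e_3e_1=\lambda^{-1} e_5, e_3e_2=e_6, e_4e_1=e_5, e_4e_2=\lambda e_6, e_5e_1=e_6$; - $B^6_{17}(\lambda)$ ($\lambda\neq 0$): $e_1e_1=e_2, e_1e_2=e_4, e_1e_3=e_5, e_1e_4=\lambda e_5+e_6, e_1e_5=\lambda e_6, e_2e_1=e_3, e_2e_2=e_5, e_2e_3=e_6, e_2e_4=\lambda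 e_6, e_3e_1=\lambda^{-1} e_5, e_3e_2=e_6, e_4e_1=e_5, e_4e_2=\lambda e_6, e_5e_1=e_6$; - $B^6_{18}(\lambda)$: $e_1e_1=e_2, e_1e_2=e_4, e_1e_3=e_5, e_1e_4=e_5+\lambda e_6, e_1e_5=e_6, e_2e_1=e_3, e_2e_2=e_5, e_2e_3=e_6, e_2e_4=e_6, e_3e_1=e_5+e_6, e_3e_2=e_6, e_4e_1=e_5, e_4e_2=e_6, e_5e_1=e_6$; - $B^6_{19}$: $e_1e_1=e_2, e_1e_2=e_4, e_1e_3=e_5, e_1e_4=e_6, e_2e_1=e_3, e_2e_2=e_5, e_2e_3=e_6, e_3e_1=e_4, e_3e_2=e_6, e_4e_1=e_5, e_5e_1=e_6$; - $B^6_{20}$: $e_1e_1=e_2, e_1e_2=e_5, e_1e_3=e_6, e_2e_1=e_3, e_2e_2=e_6, e_3e_1=e_4, e_4e_1=e_5, e_5e_1=e_6$; - $B^6_{21}$: $e_1e_1=e_2, e_1e_2=e_6, e_2e_1=e_3, e_3e_1=e_4, e_4e_1=e_5, e_5e_1=e_6$; - $B^6_{22}$: $e_1e_1=e_2, e_2e_1=e_3,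 e_3e_1=e_4, e_4e_1=e_5, e_5e_1=e_6$; - $B^6_{23}$: $e_1e_1=e_2, e_1e_2=e_3, e_1e_3=e_4, e_1e_4=e_5, e_1e_5=e_6, e_2e_1=e_4, e_2e_2=e_5, e_2e_3=e_6, e_3e_1=e_5, e_3e_2=e_6, e_4e_1=e_6$; - $B^6_{24}$: $e_1e_1=e_2, e_1e_2=e_3, e_1e_3=e_4, e_1e_4=e_5, e_1e_5=e_6, e_2e_1=e_3+e_4, e_2e_2=e_4+e_5, e_2e_3=e_5+e_6, e_2e_4=e_6, e_3e_1=e_4+e_5, e_3e_2=e_5+e_6, e_3e_3=e_6, e_4e_1=e_5+e_6, e_4e_2=e_6, e_5e_1=e_6$; - $B^6_{25}(\lambda)$: $e_1e_1=e_2, e_1e_2=e_3, e_1e_3=e_4, e_1e_4=e_5, e_1e_5=e_6, e_2e_1=\lambda e_3, e_2e_2=\lambda e_4, e_2e_3=\lambda e_5, e_2e_4=\lambda e_6, e_3e_1=\lambda e_4, e_3e_2=\lambda e_5, e_3e_3=\lambda e_6, e_4e_1=\lambda e_5, e_4e_2=\lambda e_6, e_5e_1=\lambda e_6$; - $B^6_{26}$: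 $e_1e_1=e_2, e_1e_2=e_3, e_1e_3=e_4, e_1e_4=e_5, e_1e_5=e_6, e_2e_1=e_6$; - $B^6_{27}$: $e_1e_1=e_2, e_1e_2=e_3, e_1e_3=e_4, e_1e_4=e_5, e_1e_5=e_6, e_2e_1=e_3+e_6, e_2e_2=e_4, e_2e_3=e_5, e_2e_4=e_6, e_3e_1=e_4, e_3e_2=e_5, e_3e_3=e_6, e_4e_1=e_5, e_4e_2=e_6, e_5e_1=e_6$; - $B^6_{28}$: $e_1e_1=e_2, e_1e_2=e_3, e_1e_3=e_4, e_1e_4=e_5, e_1e_5=e_6, e_2e_1=e_5, e_2e_2=e_6, e_3e_1=e_6$; - $B^6_{29}$: $e_1e_1=e_2, e_1e_2=e_3, e_1e_3=e_4, e_1e_4=e_5, e_1e_5=e_6, e_2e_1=e_3+e_5, e_2e_2=e_4+e_6, e_2e_3=e_5, e_2e_4=e_6, e_3e_1=e_4+e_6, e_3e_2=e_5, e_3e_3=e_6, e_4e_1=e_5, e_4e_2=e_6, e_5e_1=e_6$. -/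

import Mathlib

namespace Bicomm

section Notions

variable (A : Type*) [NonUnitalNonAssocRing A]

/-- Right- and left-commutativity: `(xy)z = (xz)y` and `x(yz) = y(xz)`. -/
def IsBicommutative : Prop :=
  (∀ x y z : A, (x * y) * z = (x * z) * y) ∧ (∀ x y z : A, x * (y * z) = y * (x * z))

variable {A} in
/-- `IsProduct n x`: the element `x` is a product of `n` elements, bracketed in some way. -/
inductive IsProduct : ℕ → A → Prop
  | of (x : A) : IsProduct 1 x
  | mul {p q : ℕ} {x y : A} : IsProduct p x → IsProduct q y → IsProduct (p + q) (x * y)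

/-- For some `n ≥ 1`, every product of `n` elements, however bracketed, is zero. -/
def IsNilpotentAlgebra : Prop :=
  ∃ n : ℕ, 1 ≤ n ∧ ∀ x : A, IsProduct n x → x = 0

variable [Module ℂ A]

/-- Some element of `A` is contained in no proper (non-unital) subalgebra. -/
def IsOneGenerated [IsScalarTower ℂ A A] [SMulCommClass ℂ A A] : Prop :=
  ∃ x : A, NonUnitalAlgebra.adjoin ℂ {x} = ⊤

/-- Isomorphism of complex algebras: a linear bijection that respects the products. -/
def Isomorphic (B : Type*) [NonUnitalNonAssocRing B] [Module ℂ B] : Prop :=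
  ∃ f : A ≃ₗ[ℂ] B, ∀ x y : A, f (x * y) = f x * f y

end Notions

/-- The basis vectors `e 1, …, e 6` of `ℂ⁶`. -/
def e (k : ℕ) : Fin 6 → ℂ := fun i => if (i : ℕ) + 1 = k then 1 else 0

/-- A multiplication table: `T i j` is the product of the `i`-th and the `j`-th basis vector,
for `1 ≤ i, j ≤ 6` (the other values are never used). -/
abbrev Table : Type := ℕ → ℕ → (Fin 6 → ℂ)

/-- The complex algebra with underlying space `ℂ⁶` and multiplication table `T`. -/
def TableAlgebra (_T : Table) : Type := Fin 6 → ℂ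

namespace TableAlgebra

variable (T : Table)

instance : AddCommGroup (TableAlgebra T) := inferInstanceAs (AddCommGroup (Fin 6 → ℂ))

instance : Module ℂ (TableAlgebra T) := inferInstanceAs (Module ℂ (Fin 6 → ℂ))

/-- The bilinear extension of the multiplication table. -/
def mulVec (x y : Fin 6 → ℂ) : Fin 6 → ℂ :=
  ∑ i : Fin 6, ∑ j : Fin 6, (x i * y j) • T ((i : ℕ) + 1) ((j : ℕ) + 1)

instance : Mul (TableAlgebra T) := ⟨fun x y => mulVec T x y⟩

instance : NonUnitalNonAssocRing (TableAlgebra T) :=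
  { (inferInstance : AddCommGroup (TableAlgebra T)),
    (inferInstance : Mul (TableAlgebra T)) with
    left_distrib := fun x y z => by
      change mulVec T x (fun i => y i + z i) = mulVec T x y + mulVec T x z
      simp only [mulVec, mul_add, add_smul, Finset.sum_add_distrib]
    right_distrib := fun x y z => by
      change mulVec T (fun i => x i + y i) z = mulVec T x z + mulVec T y z
      simp only [mulVec, add_mul, add_smul, Finset.sum_add_distrib]
    zero_mul := fun x => by
      change mulVec T (fun _ => 0) x = 0
      simp [mulVec]
    mul_zero := fun x => by
      change mulVec T x (fun _ => 0) = 0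
      simp [mulVec] }

instance : IsScalarTower ℂ (TableAlgebra T) (TableAlgebra T) := ⟨fun c x y => by
  change mulVec T (fun i => c * x i) y = c • mulVec T x y
  simp only [mulVec, Finset.smul_sum, smul_smul, mul_assoc]⟩

instance : SMulCommClass ℂ (TableAlgebra T) (TableAlgebra T) := ⟨fun c x y => by
  change c • mulVec T x y = mulVec T x (fun i => c * y i)
  simp only [mulVec, Finset.smul_sum, smul_smul, mul_left_comm]⟩

end TableAlgebra

/-! The multiplication tables of the list; products that are not shown are zero. -/

noncomputable def B01 : Table
  | 1, 1 => e 2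
  | 1, 2 => e 4
  | 1, 4 => e 5
  | 2, 1 => e 3
  | 3, 1 => e 6
  | _, _ => 0

noncomputable def B02 (l : ℂ) : Table
  | 1, 1 => e 2
  | 1, 2 => e 4
  | 1, 3 => e 6
  | 1, 4 => e 5
  | 2, 1 => e 3
  | 2, 2 => e 6
  | 3, 1 => l • e 6
  | 4, 1 => e 6
  | _, _ => 0

noncomputable def B03 (l m : ℂ) : Table
  | 1, 1 => e 2
  | 1, 2 => e 4
  | 1, 3 => e 6
  | 1, 4 => l • e 5 + m • e 6
  | 2, 1 => e 3
  | 2, 2 => e 6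
  | 3, 1 => e 5
  | 4, 1 => e 6
  | _, _ => 0

noncomputable def B04 : Table
  | 1, 1 => e 2
  | 1, 2 => e 4
  | 1, 3 => e 6
  | 2, 1 => e 3
  | 2, 2 => e 6
  | 3, 1 => e 4 + e 5
  | 4, 1 => e 6
  | _, _ => 0

noncomputable def B05 : Table
  | 1, 1 => e 2
  | 1, 2 => e 5
  | 2, 1 => e 3
  | 3, 1 => e 4
  | 4, 1 => e 6
  | _, _ => 0

noncomputable def B06 : Table
  | 1, 1 => e 2
  | 1, 2 => e 3
  | 1, 3 => e 4
  | 1, 4 => e 6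
  | 2, 1 => e 4 + e 5
  | 2, 2 => e 6
  | 3, 1 => e 6
  | _, _ => 0

noncomputable def B07 : Table
  | 1, 1 => e 2
  | 1, 2 => e 3
  | 1, 3 => e 4
  | 1, 4 => e 6
  | 2, 1 => e 3 + e 4 + e 5
  | 2, 2 => e 4 + e 6
  | 2, 3 => e 6
  | 3, 1 => e 4 + e 6
  | 3, 2 => e 6
  | 4, 1 => e 6
  | _, _ => 0

noncomputable def B08 (l : ℂ) : Table
  | 1, 1 => e 2
  | 1, 2 => e 3
  | 1, 3 => e 4
  | 1, 4 => e 6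
  | 2, 1 => l • e 3 + e 5
  | 2, 2 => l • e 4
  | 2, 3 => l • e 6
  | 3, 1 => l • e 4
  | 3, 2 => l • e 6
  | 4, 1 => l • e 6
  | _, _ => 0

noncomputable def B09 (l : ℂ) : Table
  | 1, 1 => e 2
  | 1, 2 => e 4
  | 1, 3 => e 6
  | 1, 4 => l • e 6
  | 2, 1 => e 3
  | 2, 2 => e 6
  | 3, 1 => e 5
  | 4, 1 => e 6
  | 5, 1 => e 6
  | _, _ => 0

noncomputable def B10 : Table
  | 1, 1 => e 2
  | 1, 2 => e 4
  | 1, 4 => e 6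
  | 2, 1 => e 3
  | 3, 1 => e 5
  | 5, 1 => e 6
  | _, _ => 0

noncomputable def B11 : Table
  | 1, 1 => e 2
  | 1, 2 => e 4
  | 2, 1 => e 3
  | 3, 1 => e 5
  | 5, 1 => e 6
  | _, _ => 0

noncomputable def B12 (l : ℂ) : Table
  | 1, 1 => e 2
  | 1, 2 => e 3
  | 1, 3 => e 5
  | 1, 5 => e 6
  | 2, 1 => l • e 3 + e 4
  | 2, 2 => l • e 5
  | 2, 3 => l • e 6
  | 3, 1 => l • e 5
  | 3, 2 => l • e 6
  | 5, 1 => l • e 6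
  | _, _ => 0

noncomputable def B13 (l : ℂ) : Table
  | 1, 1 => e 2
  | 1, 2 => e 3
  | 1, 3 => e 5
  | 1, 5 => e 6
  | 2, 1 => l • e 3 + e 4
  | 2, 2 => l • e 5
  | 2, 3 => l • e 6
  | 3, 1 => l • e 5
  | 3, 2 => l • e 6
  | 4, 1 => e 6
  | 5, 1 => l • e 6
  | _, _ => 0

noncomputable def B14 (l : ℂ) : Table
  | 1, 1 => e 2
  | 1, 2 => e 3
  | 1, 3 => e 5
  | 1, 4 => e 6
  | 1, 5 => e 6
  | 2, 1 => e 4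
  | 2, 2 => e 6
  | 3, 1 => e 6
  | 4, 1 => l • e 6
  | _, _ => 0

noncomputable def B15 (l : ℂ) : Table
  | 1, 1 => e 2
  | 1, 2 => e 3
  | 1, 3 => e 5
  | 1, 4 => e 6
  | 1, 5 => e 6
  | 2, 1 => e 3 + e 4
  | 2, 2 => e 5 + e 6
  | 2, 3 => e 6
  | 3, 1 => e 5 + e 6
  | 3, 2 => e 6
  | 4, 1 => l • e 6
  | 5, 1 => e 6
  | _, _ => 0

noncomputable def B16 (l : ℂ) : Table
  | 1, 1 => e 2
  | 1, 2 => e 4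
  | 1, 3 => e 5
  | 1, 4 => l • e 5
  | 1, 5 => l • e 6
  | 2, 1 => e 3
  | 2, 2 => e 5
  | 2, 3 => e 6
  | 2, 4 => l • e 6
  | 3, 1 => (1 / l) • e 5
  | 3, 2 => e 6
  | 4, 1 => e 5
  | 4, 2 => l • e 6
  | 5, 1 => e 6
  | _, _ => 0

noncomputable def B17 (l : ℂ) : Table
  | 1, 1 => e 2
  | 1, 2 => e 4
  | 1, 3 => e 5
  | 1, 4 => l • e 5 + e 6
  | 1, 5 => l • e 6
  | 2, 1 => e 3
  | 2, 2 => e 5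
  | 2, 3 => e 6
  | 2, 4 => l • e 6
  | 3, 1 => (1 / l) • e 5
  | 3, 2 => e 6
  | 4, 1 => e 5
  | 4, 2 => l • e 6
  | 5, 1 => e 6
  | _, _ => 0

noncomputable def B18 (l : ℂ) : Table
  | 1, 1 => e 2
  | 1, 2 => e 4
  | 1, 3 => e 5
  | 1, 4 => e 5 + l • e 6
  | 1, 5 => e 6
  | 2, 1 => e 3
  | 2, 2 => e 5
  | 2, 3 => e 6
  | 2, 4 => e 6
  | 3, 1 => e 5 + e 6
  | 3, 2 => e 6
  | 4, 1 => e 5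
  | 4, 2 => e 6
  | 5, 1 => e 6
  | _, _ => 0

noncomputable def B19 : Table
  | 1, 1 => e 2
  | 1, 2 => e 4
  | 1, 3 => e 5
  | 1, 4 => e 6
  | 2, 1 => e 3
  | 2, 2 => e 5
  | 2, 3 => e 6
  | 3, 1 => e 4
  | 3, 2 => e 6
  | 4, 1 => e 5
  | 5, 1 => e 6
  | _, _ => 0

noncomputable def B20 : Table
  | 1, 1 => e 2
  | 1, 2 => e 5
  | 1, 3 => e 6
  | 2, 1 => e 3
  | 2, 2 => e 6
  | 3, 1 => e 4
  | 4, 1 => e 5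
  | 5, 1 => e 6
  | _, _ => 0

noncomputable def B21 : Table
  | 1, 1 => e 2
  | 1, 2 => e 6
  | 2, 1 => e 3
  | 3, 1 => e 4
  | 4, 1 => e 5
  | 5, 1 => e 6
  | _, _ => 0

noncomputable def B22 : Table
  | 1, 1 => e 2
  | 2, 1 => e 3
  | 3, 1 => e 4
  | 4, 1 => e 5
  | 5, 1 => e 6
  | _, _ => 0

noncomputable def B23 : Table
  | 1, 1 => e 2
  | 1, 2 => e 3
  | 1, 3 => e 4
  | 1, 4 => e 5
  | 1, 5 => e 6
  | 2, 1 => e 4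
  | 2, 2 => e 5
  | 2, 3 => e 6
  | 3, 1 => e 5
  | 3, 2 => e 6
  | 4, 1 => e 6
  | _, _ => 0

noncomputable def B24 : Table
  | 1, 1 => e 2
  | 1, 2 => e 3
  | 1, 3 => e 4
  | 1, 4 => e 5
  | 1, 5 => e 6
  | 2, 1 => e 3 + e 4
  | 2, 2 => e 4 + e 5
  | 2, 3 => e 5 + e 6
  | 2, 4 => e 6
  | 3, 1 => e 4 + e 5
  | 3, 2 => e 5 + e 6
  | 3, 3 => e 6
  | 4, 1 => e 5 + e 6
  | 4, 2 => e 6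
  | 5, 1 => e 6
  | _, _ => 0

noncomputable def B25 (l : ℂ) : Table
  | 1, 1 => e 2
  | 1, 2 => e 3
  | 1, 3 => e 4
  | 1, 4 => e 5
  | 1, 5 => e 6
  | 2, 1 => l • e 3
  | 2, 2 => l • e 4
  | 2, 3 => l • e 5
  | 2, 4 => l • e 6
  | 3, 1 => l • e 4
  | 3, 2 => l • e 5
  | 3, 3 => l • e 6
  | 4, 1 => l • e 5
  | 4, 2 => l • e 6
  | 5, 1 => l • e 6
  | _, _ => 0

noncomputable def B26 : Table
  | 1, 1 => e 2
  | 1, 2 => e 3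
  | 1, 3 => e 4
  | 1, 4 => e 5
  | 1, 5 => e 6
  | 2, 1 => e 6
  | _, _ => 0

noncomputable def B27 : Table
  | 1, 1 => e 2
  | 1, 2 => e 3
  | 1, 3 => e 4
  | 1, 4 => e 5
  | 1, 5 => e 6
  | 2, 1 => e 3 + e 6
  | 2, 2 => e 4
  | 2, 3 => e 5
  | 2, 4 => e 6
  | 3, 1 => e 4
  | 3, 2 => e 5
  | 3, 3 => e 6
  | 4, 1 => e 5
  | 4, 2 => e 6
  | 5, 1 => e 6
  | _, _ => 0

noncomputable def B28 : Table
  | 1, 1 => e 2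
  | 1, 2 => e 3
  | 1, 3 => e 4
  | 1, 4 => e 5
  | 1, 5 => e 6
  | 2, 1 => e 5
  | 2, 2 => e 6
  | 3, 1 => e 6
  | _, _ => 0

noncomputable def B29 : Table
  | 1, 1 => e 2
  | 1, 2 => e 3
  | 1, 3 => e 4
  | 1, 4 => e 5
  | 1, 5 => e 6
  | 2, 1 => e 3 + e 5
  | 2, 2 => e 4 + e 6
  | 2, 3 => e 5
  | 2, 4 => e 6
  | 3, 1 => e 4 + e 6
  | 3, 2 => e 5
  | 3, 3 => e 6
  | 4, 1 => e 5
  | 4, 2 => e 6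
  | 5, 1 => e 6
  | _, _ => 0

/-- The tables of the list, for all admissible values of the parameters. -/
inductive IsListed : Table → Prop
  | b01 : IsListed B01
  | b02 (l : ℂ) : IsListed (B02 l)
  | b03 (l m : ℂ) : IsListed (B03 l m)
  | b04 : IsListed B04
  | b05 : IsListed B05
  | b06 : IsListed B06
  | b07 : IsListed B07
  | b08 (l : ℂ) : IsListed (B08 l)
  | b09 (l : ℂ) : IsListed (B09 l)
  | b10 : IsListed B10
  | b11 : IsListed B11
  | b12 (l : ℂ) : IsListed (B12 l)
  | b13 (l : ℂ) : IsListed (B13 l)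
  | b14 (l : ℂ) : IsListed (B14 l)
  | b15 (l : ℂ) : IsListed (B15 l)
  | b16 (l : ℂ) (hl : l ≠ 0) : IsListed (B16 l)
  | b17 (l : ℂ) (hl : l ≠ 0) : IsListed (B17 l)
  | b18 (l : ℂ) : IsListed (B18 l)
  | b19 : IsListed B19
  | b20 : IsListed B20
  | b21 : IsListed B21
  | b22 : IsListed B22
  | b23 : IsListed B23
  | b24 : IsListed B24
  | b25 (l : ℂ) : IsListed (B25 l)
  | b26 : IsListed B26
  | b27 : IsListed B27
  | b28 : IsListed B28
  | b29 : IsListed B29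

end Bicomm

/-!
Let `a` generate `A`. On the square `A²`, the operators of left and right multiplication by `a`
commute and are nilpotent, so they generate a commutative local algebra `Q` with residue field `ℂ`,
whose maximal ideal is generated by these two elements `l` and `r`. The map
`(c, f) ↦ c a + f (a a)` is a bijection `ℂ × Q → A`, under which the product becomes
`(c, p) (d, q) = (0, (c + r p) (d + l q))`: a one-generated nilpotent bicommutative algebra is the
same as a pair `l, r` generating the maximal ideal `M` of a finite local algebra, here of
dimension 5. The generator `(c, p)` in place of `(1, 0)` replaces the pair by
`(l (c + r p), r (c + l p))`.

If `M` is principal, it is generated by `l` or `r`, and Hensel's lemma provides a generator `(c, p)`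
for which the other element is a monomial, possibly up to adding the first element. Otherwise
`dim M² ≤ 2`: either `M³ = 0` and a quadratic relation between `l` and `r` is a normal form, or `M²`
and `M³` have dimensions 2 and 1, and then a combination of `l` and `r` annihilates `M²`, which
leaves two scalars to be normalized.
-/

namespace Bicomm

section Isomorphic

variable {A B C : Type*} [NonUnitalNonAssocRing A] [Module ℂ A] [NonUnitalNonAssocRing B]
  [Module ℂ B] [NonUnitalNonAssocRing C] [Module ℂ C]

theorem Isomorphic.symm : Isomorphic A B → Isomorphic B A := by
  rintro ⟨f, hf⟩
  exact ⟨f.symm, fun x y => f.injective (by simp [hf])⟩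

theorem Isomorphic.trans : Isomorphic A B → Isomorphic B C → Isomorphic A C := by
  rintro ⟨f, hf⟩ ⟨g, hg⟩
  exact ⟨f.trans g, fun x y => by simp [hf, hg]⟩

variable [IsScalarTower ℂ A A] [SMulCommClass ℂ A A]

theorem isomorphic_tableAlgebra_of_basis {T : Table} (b : Module.Basis (Fin 6) ℂ A)
    (hb : ∀ i j : Fin 6, b i * b j = ∑ k, T (i + 1) (j + 1) k • b k) :
    Isomorphic A (TableAlgebra T) := by
  refine ⟨b.equivFun, fun x y => ?_⟩
  change b.equivFun (x * y) = TableAlgebra.mulVec T (b.equivFun x) (b.equivFun y)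
  rw [← LinearEquiv.eq_symm_apply, TableAlgebra.mulVec]
  conv_lhs => rw [← b.sum_equivFun x, ← b.sum_equivFun y]
  simp only [Finset.sum_mul_sum, smul_mul_smul_comm, hb, map_sum, map_smul,
    Module.Basis.equivFun_symm_apply]

theorem isomorphic_tableAlgebra_of_adjoin_eq_top {T : Table} (hdim : Module.finrank ℂ A = 6)
    (v : Fin 6 → A) (hgen : NonUnitalAlgebra.adjoin ℂ {v 0} = ⊤)
    (hv : ∀ i j : Fin 6, v i * v j = ∑ k, T (i + 1) (j + 1) k • v k) :
    Isomorphic A (TableAlgebra T) := by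
  have hmul : ∀ {x y}, x ∈ Submodule.span ℂ (Set.range v) → y ∈ Submodule.span ℂ (Set.range v) →
      x * y ∈ Submodule.span ℂ (Set.range v) := by
    intro x y hx hy
    induction hx, hy using Submodule.span_induction₂ with
    | mem_mem x y hx hy =>
      obtain ⟨⟨i, rfl⟩, j, rfl⟩ := And.intro hx hy
      rw [hv]
      exact sum_mem fun k _ => Submodule.smul_mem _ _ (Submodule.subset_span ⟨k, rfl⟩)
    | zero_left => simp
    | zero_right => simp
    | add_left x y z _ _ _ hx hy => rw [add_mul]; exact add_mem hx hy
    | add_right x y z _ _ _ hx hy => rw [mul_add]; exact add_mem hx hy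
    | smul_left c x y _ _ hx => rw [smul_mul_assoc]; exact Submodule.smul_mem _ _ hx
    | smul_right c x y _ _ hx => rw [mul_smul_comm]; exact Submodule.smul_mem _ _ hx
  let S : NonUnitalSubalgebra ℂ A := { Submodule.span ℂ (Set.range v) with mul_mem' := hmul }
  have hS : NonUnitalAlgebra.adjoin ℂ {v 0} ≤ S :=
    NonUnitalAlgebra.adjoin_le (Set.singleton_subset_iff.mpr (Submodule.subset_span ⟨0, rfl⟩))
  have hspan : ⊤ ≤ Submodule.span ℂ (Set.range v) := fun x _ =>
    hS (hgen ▸ NonUnitalAlgebra.mem_top)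
  exact isomorphic_tableAlgebra_of_basis
    (basisOfTopLeSpanOfCardEqFinrank v hspan (by simp [hdim])) (by simpa using hv)

end Isomorphic

/-- The algebra attached to a pair of elements of a commutative algebra `Q`: the space `ℂ × Q`
with the product `(c, p) (d, q) = (0, (c + r p) (d + l q))`. The element `(1, 0)` is the intended
generator; it multiplies `0 × Q` by `l` from the left and by `r` from the right. -/
def PairAlgebra {Q : Type*} (_l _r : Q) : Type _ := ℂ × Q

namespace PairAlgebra

variable {Q : Type*} {l r : Q}

@[ext] theorem ext {x y : PairAlgebra l r} (h₁ : x.1 = y.1) (h₂ : x.2 = y.2) : x = y :=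
  Prod.ext h₁ h₂

variable [CommRing Q]

instance : AddCommGroup (PairAlgebra l r) := inferInstanceAs (AddCommGroup (ℂ × Q))

@[simp] theorem fst_zero : (0 : PairAlgebra l r).1 = 0 := rfl

@[simp] theorem snd_zero : (0 : PairAlgebra l r).2 = 0 := rfl

@[simp] theorem fst_add (x y : PairAlgebra l r) : (x + y).1 = x.1 + y.1 := rfl

@[simp] theorem snd_add (x y : PairAlgebra l r) : (x + y).2 = x.2 + y.2 := rfl

variable [Algebra ℂ Q]

instance : Module ℂ (PairAlgebra l r) := inferInstanceAs (Module ℂ (ℂ × Q))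

instance : Mul (PairAlgebra l r) :=
  ⟨fun x y => (0, (algebraMap ℂ Q x.1 + r * x.2) * (algebraMap ℂ Q y.1 + l * y.2))⟩

@[simp] theorem fst_smul (c : ℂ) (x : PairAlgebra l r) : (c • x).1 = c * x.1 := rfl

@[simp] theorem snd_smul (c : ℂ) (x : PairAlgebra l r) : (c • x).2 = c • x.2 := rfl

@[simp] theorem fst_mul (x y : PairAlgebra l r) : (x * y).1 = 0 := rfl

@[simp] theorem snd_mul (x y : PairAlgebra l r) :
    (x * y).2 = (algebraMap ℂ Q x.1 + r * x.2) * (algebraMap ℂ Q y.1 + l * y.2) := rfl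

instance : NonUnitalNonAssocRing (PairAlgebra l r) :=
  { (inferInstance : AddCommGroup (PairAlgebra l r)), (inferInstance : Mul (PairAlgebra l r)) with
    left_distrib := fun x y z => by ext <;> simp; ring
    right_distrib := fun x y z => by ext <;> simp; ring
    zero_mul := fun x => by ext <;> simp
    mul_zero := fun x => by ext <;> simp }

instance : IsScalarTower ℂ (PairAlgebra l r) (PairAlgebra l r) :=
  ⟨fun c x y => by ext <;> simp [Algebra.smul_def]; ring⟩

instance : SMulCommClass ℂ (PairAlgebra l r) (PairAlgebra l r) :=
  ⟨fun c x y => by ext <;> simp [Algebra.smul_def]; ring⟩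

end PairAlgebra

theorem forall_fin_six {P : Fin 6 → Prop} :
    (∀ i, P i) ↔ P 0 ∧ P 1 ∧ P 2 ∧ P 3 ∧ P 4 ∧ P 5 := by
  simp [Fin.forall_fin_succ]

section LocalAlgebra

open IsLocalRing

variable {Q : Type*} [CommRing Q] [IsLocalRing Q] {l r : Q}

theorem left_mem_maximalIdeal (hM : Ideal.span {l, r} = maximalIdeal Q) : l ∈ maximalIdeal Q :=
  hM ▸ Ideal.subset_span (by simp)

theorem right_mem_maximalIdeal (hM : Ideal.span {l, r} = maximalIdeal Q) : r ∈ maximalIdeal Q :=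
  hM ▸ Ideal.subset_span (by simp)

variable [Algebra ℂ Q] [Module.Finite ℂ Q]

theorem isNilpotent_maximalIdeal : IsNilpotent (maximalIdeal Q) := by
  have : IsArtinianRing Q := isArtinian_of_tower ℂ inferInstance
  rw [← jacobson_eq_maximalIdeal ⊥ bot_ne_top]
  exact IsArtinianRing.isNilpotent_jacobson_bot

theorem exists_sub_algebraMap_mem_maximalIdeal (q : Q) :
    ∃ s : ℂ, q - algebraMap ℂ Q s ∈ maximalIdeal Q := by
  obtain ⟨s, hs⟩ :=
    (IsAlgClosed.algebraMap_bijective_of_isIntegral (k := ℂ) (K := ResidueField Q)).2 (residue Q q)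
  refine ⟨s, (residue_eq_zero_iff _).1 ?_⟩
  rw [map_sub, ← hs, IsScalarTower.algebraMap_apply ℂ Q, ResidueField.algebraMap_eq, sub_self]

theorem exists_eq_algebraMap_add (hM : Ideal.span {l, r} = maximalIdeal Q) (q : Q) :
    ∃ (s : ℂ) (x y : Q), q = algebraMap ℂ Q s + l * x + r * y := by
  obtain ⟨s, hs⟩ := exists_sub_algebraMap_mem_maximalIdeal q
  rw [← hM, Ideal.mem_span_pair] at hs
  obtain ⟨x, y, h⟩ := hs
  exact ⟨s, x, y, by linear_combination -h⟩

theorem eq_top_of_mul_mem (hM : Ideal.span {l, r} = maximalIdeal Q) {V : Submodule ℂ Q}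
    (hone : 1 ∈ V) (hl : ∀ v ∈ V, l * v ∈ V) (hr : ∀ v ∈ V, r * v ∈ V) : V = ⊤ := by
  have approx (n : ℕ) (q : Q) : ∃ v ∈ V, q - v ∈ maximalIdeal Q ^ n := by
    induction n generalizing q with
    | zero => exact ⟨0, V.zero_mem, by simp⟩
    | succ n ih =>
      obtain ⟨s, x, y, rfl⟩ := exists_eq_algebraMap_add hM q
      obtain ⟨⟨v, hv, hxv⟩, w, hw, hyw⟩ := And.intro (ih x) (ih y)
      refine ⟨s • 1 + l * v + r * w,
        add_mem (add_mem (V.smul_mem s hone) (hl v hv)) (hr w hw), ?_⟩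
      have hsum := add_mem (Ideal.mul_mem_mul (left_mem_maximalIdeal hM) hxv)
        (Ideal.mul_mem_mul (right_mem_maximalIdeal hM) hyw)
      rw [pow_succ']
      convert hsum using 1
      rw [Algebra.smul_def]
      ring
  obtain ⟨n, hn⟩ := isNilpotent_maximalIdeal (Q := Q)
  refine eq_top_iff.2 fun q _ => ?_
  obtain ⟨v, hv, hqv⟩ := approx n q
  rw [hn, Ideal.zero_eq_bot, Ideal.mem_bot, sub_eq_zero] at hqv
  exact hqv ▸ hv

end LocalAlgebra

namespace PairAlgebra

open IsLocalRing

variable {Q : Type*} [CommRing Q] {l r : Q}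

variable (l r) in
/-- The generator `(1, 0)`. -/
def gen : PairAlgebra l r := ((1, 0) : ℂ × Q)

@[simp] theorem fst_gen : (gen l r).1 = 1 := rfl

@[simp] theorem snd_gen : (gen l r).2 = 0 := rfl

variable [Algebra ℂ Q]

variable (l r) in
/-- The inclusion of `Q` as the second component. -/
def incl : Q →ₗ[ℂ] PairAlgebra l r := LinearMap.inr ℂ ℂ Q

@[simp] theorem fst_incl (q : Q) : (incl l r q).1 = 0 := rfl

@[simp] theorem snd_incl (q : Q) : (incl l r q).2 = q := rfl

theorem gen_mul_gen : gen l r * gen l r = incl l r 1 := by ext <;> simp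

theorem gen_mul_incl (q : Q) : gen l r * incl l r q = incl l r (l * q) := by ext <;> simp

theorem incl_mul_gen (q : Q) : incl l r q * gen l r = incl l r (r * q) := by ext <;> simp

theorem eq_smul_gen_add_incl (x : PairAlgebra l r) : x = x.1 • gen l r + incl l r x.2 := by
  ext <;> simp

theorem finrank_eq_add_one [Module.Finite ℂ Q] :
    Module.finrank ℂ (PairAlgebra l r) = Module.finrank ℂ Q + 1 :=
  (Module.finrank_prod (R := ℂ) (M := ℂ) (M' := Q)).trans (by rw [Module.finrank_self, add_comm])

variable [IsLocalRing Q] [Module.Finite ℂ Q]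

theorem adjoin_gen (hM : Ideal.span {l, r} = maximalIdeal Q) :
    NonUnitalAlgebra.adjoin ℂ {gen l r} = ⊤ := by
  set S := NonUnitalAlgebra.adjoin ℂ {gen l r}
  have hgen : gen l r ∈ S := NonUnitalAlgebra.self_mem_adjoin_singleton ℂ _
  have hincl : S.toSubmodule.comap (incl l r) = ⊤ := by
    refine eq_top_of_mul_mem hM ?_ (fun v hv => ?_) fun v hv => ?_
    · rw [Submodule.mem_comap, ← gen_mul_gen]
      exact S.mul_mem hgen hgen
    · rw [Submodule.mem_comap, ← gen_mul_incl]
      exact S.mul_mem hgen hv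
    · rw [Submodule.mem_comap, ← incl_mul_gen]
      exact S.mul_mem hv hgen
  refine NonUnitalAlgebra.eq_top_iff.2 fun x => ?_
  rw [eq_smul_gen_add_incl x]
  exact add_mem (SMulMemClass.smul_mem _ hgen) (Submodule.eq_top_iff'.1 hincl x.2)

/-- The sum `u₂ + u₃ x + u₄ y + u₅ z + u₆ w`, for a vector `u` of `ℂ⁶`; the index of a
coordinate is one less than in the list. -/
def combination (x y z w : Q) (u : Fin 6 → ℂ) : Q :=
  u 1 • (1 : Q) + u 2 • x + u 3 • y + u 4 • z + u 5 • w

theorem isomorphic_tableAlgebra (hQ : Module.finrank ℂ Q = 5)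
    (hM : Ideal.span {l, r} = maximalIdeal Q) {T : Table} (x y z w : Q)
    (h : ∀ i j : Fin 6, T (i + 1) (j + 1) 0 = 0 ∧
      ![1, r, r * x, r * y, r * z, r * w] i * ![1, l, l * x, l * y, l * z, l * w] j =
        combination x y z w (T (i + 1) (j + 1))) :
    Isomorphic (PairAlgebra l r) (TableAlgebra T) := by
  refine isomorphic_tableAlgebra_of_adjoin_eq_top (by rw [finrank_eq_add_one, hQ])
    ![gen l r, incl l r 1, incl l r x, incl l r y, incl l r z, incl l r w] (adjoin_gen hM)
    fun i j => ?_
  ext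
  · simp [Fin.sum_univ_six, (h i j).1]
  · trans combination x y z w (T (i + 1) (j + 1))
    · rw [← (h i j).2]
      fin_cases i <;> fin_cases j <;> simp
    · simp [Fin.sum_univ_six, combination]

theorem isomorphic_B01 (hQ : Module.finrank ℂ Q = 5)
    (hM : Ideal.span {l, r} = maximalIdeal Q)
    (hlr : l * r = 0) (hl : l ^ 3 = 0) (hr : r ^ 3 = 0) :
    Isomorphic (PairAlgebra l r) (TableAlgebra B01) := by
  refine isomorphic_tableAlgebra hQ hM r l (l ^ 2) (r ^ 2) ?_
  simp only [forall_fin_six, B01.eq_def, Fin.coe_ofNat_eq_mod, Nat.reduceMod, Nat.reduceAdd]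
  simp [e, combination]
  grind

theorem isomorphic_B02 {c : ℂ} (hQ : Module.finrank ℂ Q = 5)
    (hM : Ideal.span {l, r} = maximalIdeal Q)
    (hr : r ^ 2 = c • (l * r)) (hlll : l ^ 3 = 0) (hllr : l ^ 2 * r = 0)
    (hlrr : l * r ^ 2 = 0) :
    Isomorphic (PairAlgebra l r) (TableAlgebra (B02 c)) := by
  refine isomorphic_tableAlgebra hQ hM r l (l ^ 2) (l * r) ?_
  simp only [forall_fin_six, B02.eq_def, Fin.coe_ofNat_eq_mod, Nat.reduceMod, Nat.reduceAdd]
  simp [e, combination]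
  grind [Algebra.smul_def]

theorem isomorphic_B03 {c d : ℂ} (hQ : Module.finrank ℂ Q = 5)
    (hM : Ideal.span {l, r} = maximalIdeal Q)
    (hl : l ^ 2 = c • r ^ 2 + d • (l * r)) (hllr : l ^ 2 * r = 0)
    (hlrr : l * r ^ 2 = 0) (hrrr : r ^ 3 = 0) :
    Isomorphic (PairAlgebra l r) (TableAlgebra (B03 c d)) := by
  refine isomorphic_tableAlgebra hQ hM r l (r ^ 2) (l * r) ?_
  simp only [forall_fin_six, B03.eq_def, Fin.coe_ofNat_eq_mod, Nat.reduceMod, Nat.reduceAdd]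
  simp [e, combination]
  grind [Algebra.smul_def]

theorem isomorphic_B09 {c : ℂ} (hQ : Module.finrank ℂ Q = 5)
    (hM : Ideal.span {l, r} = maximalIdeal Q)
    (hlr : l * r = r ^ 3) (hl : l ^ 2 = c • r ^ 3) (hr : r ^ 4 = 0) :
    Isomorphic (PairAlgebra l r) (TableAlgebra (B09 c)) := by
  refine isomorphic_tableAlgebra hQ hM r l (r ^ 2) (r ^ 3) ?_
  simp only [forall_fin_six, B09.eq_def, Fin.coe_ofNat_eq_mod, Nat.reduceMod, Nat.reduceAdd]
  simp [e, combination]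
  grind [Algebra.smul_def]

theorem isomorphic_B10 (hQ : Module.finrank ℂ Q = 5)
    (hM : Ideal.span {l, r} = maximalIdeal Q)
    (hlr : l * r = 0) (hl : l ^ 2 = r ^ 3) :
    Isomorphic (PairAlgebra l r) (TableAlgebra B10) := by
  refine isomorphic_tableAlgebra hQ hM r l (r ^ 2) (r ^ 3) ?_
  simp only [forall_fin_six, B10.eq_def, Fin.coe_ofNat_eq_mod, Nat.reduceMod, Nat.reduceAdd]
  simp [e, combination]
  grind

theorem isomorphic_B11 (hQ : Module.finrank ℂ Q = 5)
    (hM : Ideal.span {l, r} = maximalIdeal Q)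
    (hlr : l * r = 0) (hl : l ^ 2 = 0) (hr : r ^ 4 = 0) :
    Isomorphic (PairAlgebra l r) (TableAlgebra B11) := by
  refine isomorphic_tableAlgebra hQ hM r l (r ^ 2) (r ^ 3) ?_
  simp only [forall_fin_six, B11.eq_def, Fin.coe_ofNat_eq_mod, Nat.reduceMod, Nat.reduceAdd]
  simp [e, combination]
  grind

theorem isomorphic_B12 {c : ℂ} (hQ : Module.finrank ℂ Q = 5)
    (hM : Ideal.span {l, r} = maximalIdeal Q)
    (hlr : l * r = c • l ^ 2) (hr : r ^ 2 = c • (l * r)) (hl : l ^ 4 = 0) :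
    Isomorphic (PairAlgebra l r) (TableAlgebra (B12 c)) := by
  refine isomorphic_tableAlgebra hQ hM l (r - c • l) (l ^ 2) (l ^ 3) ?_
  simp only [forall_fin_six, B12.eq_def, Fin.coe_ofNat_eq_mod, Nat.reduceMod, Nat.reduceAdd]
  simp [e, combination]
  grind [Algebra.smul_def]

theorem isomorphic_B13 {c : ℂ} (hQ : Module.finrank ℂ Q = 5)
    (hM : Ideal.span {l, r} = maximalIdeal Q)
    (hlr : l * r = c • l ^ 2) (hr : r ^ 2 = c • (l * r) + l ^ 3) (hl : l ^ 4 = 0) :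
    Isomorphic (PairAlgebra l r) (TableAlgebra (B13 c)) := by
  refine isomorphic_tableAlgebra hQ hM l (r - c • l) (l ^ 2) (l ^ 3) ?_
  simp only [forall_fin_six, B13.eq_def, Fin.coe_ofNat_eq_mod, Nat.reduceMod, Nat.reduceAdd]
  simp [e, combination]
  grind [Algebra.smul_def]

theorem isomorphic_B14 {c : ℂ} (hQ : Module.finrank ℂ Q = 5)
    (hM : Ideal.span {l, r} = maximalIdeal Q)
    (hlr : l * r = l ^ 3) (hr : r ^ 2 = c • l ^ 3) (hl : l ^ 4 = 0) :
    Isomorphic (PairAlgebra l r) (TableAlgebra (B14 c)) := by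
  refine isomorphic_tableAlgebra hQ hM l r (l ^ 2) (l ^ 3) ?_
  simp only [forall_fin_six, B14.eq_def, Fin.coe_ofNat_eq_mod, Nat.reduceMod, Nat.reduceAdd]
  simp [e, combination]
  grind [Algebra.smul_def]

theorem isomorphic_B15 {c : ℂ} (hQ : Module.finrank ℂ Q = 5)
    (hM : Ideal.span {l, r} = maximalIdeal Q)
    (hlr : l * r = l ^ 2 + l ^ 3) (hr : r ^ 2 = l * r + c • l ^ 3) (hl : l ^ 4 = 0) :
    Isomorphic (PairAlgebra l r) (TableAlgebra (B15 c)) := by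
  refine isomorphic_tableAlgebra hQ hM l (r - l) (l ^ 2) (l ^ 3) ?_
  simp only [forall_fin_six, B15.eq_def, Fin.coe_ofNat_eq_mod, Nat.reduceMod, Nat.reduceAdd]
  simp [e, combination]
  grind [Algebra.smul_def]

theorem isomorphic_B19 (hQ : Module.finrank ℂ Q = 5)
    (hM : Ideal.span {r ^ 2, r} = maximalIdeal Q) (hr : r ^ 5 = 0) :
    Isomorphic (PairAlgebra (r ^ 2) r) (TableAlgebra B19) := by
  refine isomorphic_tableAlgebra hQ hM r (r ^ 2) (r ^ 3) (r ^ 4) ?_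
  simp only [forall_fin_six, B19.eq_def, Fin.coe_ofNat_eq_mod, Nat.reduceMod, Nat.reduceAdd]
  simp [e, combination]
  grind

theorem isomorphic_B20 (hQ : Module.finrank ℂ Q = 5)
    (hM : Ideal.span {r ^ 3, r} = maximalIdeal Q) (hr : r ^ 5 = 0) :
    Isomorphic (PairAlgebra (r ^ 3) r) (TableAlgebra B20) := by
  refine isomorphic_tableAlgebra hQ hM r (r ^ 2) (r ^ 3) (r ^ 4) ?_
  simp only [forall_fin_six, B20.eq_def, Fin.coe_ofNat_eq_mod, Nat.reduceMod, Nat.reduceAdd]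
  simp [e, combination]
  grind

theorem isomorphic_B21 (hQ : Module.finrank ℂ Q = 5)
    (hM : Ideal.span {r ^ 4, r} = maximalIdeal Q) (hr : r ^ 5 = 0) :
    Isomorphic (PairAlgebra (r ^ 4) r) (TableAlgebra B21) := by
  refine isomorphic_tableAlgebra hQ hM r (r ^ 2) (r ^ 3) (r ^ 4) ?_
  simp only [forall_fin_six, B21.eq_def, Fin.coe_ofNat_eq_mod, Nat.reduceMod, Nat.reduceAdd]
  simp [e, combination]
  grind

theorem isomorphic_B22 (hQ : Module.finrank ℂ Q = 5)
    (hM : Ideal.span {0, r} = maximalIdeal Q) (hr : r ^ 5 = 0) :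
    Isomorphic (PairAlgebra 0 r) (TableAlgebra B22) := by
  refine isomorphic_tableAlgebra hQ hM r (r ^ 2) (r ^ 3) (r ^ 4) ?_
  simp only [forall_fin_six, B22.eq_def, Fin.coe_ofNat_eq_mod, Nat.reduceMod, Nat.reduceAdd]
  simp [e, combination]
  grind

theorem isomorphic_B23 (hQ : Module.finrank ℂ Q = 5)
    (hM : Ideal.span {l, l ^ 2} = maximalIdeal Q) (hl : l ^ 5 = 0) :
    Isomorphic (PairAlgebra l (l ^ 2)) (TableAlgebra B23) := by
  refine isomorphic_tableAlgebra hQ hM l (l ^ 2) (l ^ 3) (l ^ 4) ?_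
  simp only [forall_fin_six, B23.eq_def, Fin.coe_ofNat_eq_mod, Nat.reduceMod, Nat.reduceAdd]
  simp [e, combination]
  grind

theorem isomorphic_B24 (hQ : Module.finrank ℂ Q = 5)
    (hM : Ideal.span {l, l + l ^ 2} = maximalIdeal Q) (hl : l ^ 5 = 0) :
    Isomorphic (PairAlgebra l (l + l ^ 2)) (TableAlgebra B24) := by
  refine isomorphic_tableAlgebra hQ hM l (l ^ 2) (l ^ 3) (l ^ 4) ?_
  simp only [forall_fin_six, B24.eq_def, Fin.coe_ofNat_eq_mod, Nat.reduceMod, Nat.reduceAdd]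
  simp [e, combination]
  grind

theorem isomorphic_B25 {c : ℂ} (hQ : Module.finrank ℂ Q = 5)
    (hM : Ideal.span {l, c • l} = maximalIdeal Q) (hl : l ^ 5 = 0) :
    Isomorphic (PairAlgebra l (c • l)) (TableAlgebra (B25 c)) := by
  refine isomorphic_tableAlgebra hQ hM l (l ^ 2) (l ^ 3) (l ^ 4) ?_
  simp only [forall_fin_six, B25.eq_def, Fin.coe_ofNat_eq_mod, Nat.reduceMod, Nat.reduceAdd]
  simp [e, combination]
  grind [Algebra.smul_def]

theorem isomorphic_B26 (hQ : Module.finrank ℂ Q = 5)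
    (hM : Ideal.span {l, l ^ 4} = maximalIdeal Q) (hl : l ^ 5 = 0) :
    Isomorphic (PairAlgebra l (l ^ 4)) (TableAlgebra B26) := by
  refine isomorphic_tableAlgebra hQ hM l (l ^ 2) (l ^ 3) (l ^ 4) ?_
  simp only [forall_fin_six, B26.eq_def, Fin.coe_ofNat_eq_mod, Nat.reduceMod, Nat.reduceAdd]
  simp [e, combination]
  grind

theorem isomorphic_B27 (hQ : Module.finrank ℂ Q = 5)
    (hM : Ideal.span {l, l + l ^ 4} = maximalIdeal Q) (hl : l ^ 5 = 0) :
    Isomorphic (PairAlgebra l (l + l ^ 4)) (TableAlgebra B27) := by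
  refine isomorphic_tableAlgebra hQ hM l (l ^ 2) (l ^ 3) (l ^ 4) ?_
  simp only [forall_fin_six, B27.eq_def, Fin.coe_ofNat_eq_mod, Nat.reduceMod, Nat.reduceAdd]
  simp [e, combination]
  grind

theorem isomorphic_B28 (hQ : Module.finrank ℂ Q = 5)
    (hM : Ideal.span {l, l ^ 3} = maximalIdeal Q) (hl : l ^ 5 = 0) :
    Isomorphic (PairAlgebra l (l ^ 3)) (TableAlgebra B28) := by
  refine isomorphic_tableAlgebra hQ hM l (l ^ 2) (l ^ 3) (l ^ 4) ?_
  simp only [forall_fin_six, B28.eq_def, Fin.coe_ofNat_eq_mod, Nat.reduceMod, Nat.reduceAdd]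
  simp [e, combination]
  grind

theorem isomorphic_B29 (hQ : Module.finrank ℂ Q = 5)
    (hM : Ideal.span {l, l + l ^ 3} = maximalIdeal Q) (hl : l ^ 5 = 0) :
    Isomorphic (PairAlgebra l (l + l ^ 3)) (TableAlgebra B29) := by
  refine isomorphic_tableAlgebra hQ hM l (l ^ 2) (l ^ 3) (l ^ 4) ?_
  simp only [forall_fin_six, B29.eq_def, Fin.coe_ofNat_eq_mod, Nat.reduceMod, Nat.reduceAdd]
  simp [e, combination]
  grind

end PairAlgebra

/-- The conclusion of the classification: `A` is isomorphic to an algebra of the list. -/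
def HasListedTable (A : Type*) [NonUnitalNonAssocRing A] [Module ℂ A] : Prop :=
  ∃ T, IsListed T ∧ Isomorphic A (TableAlgebra T)

theorem HasListedTable.of_isomorphic {A B : Type*} [NonUnitalNonAssocRing A] [Module ℂ A]
    [NonUnitalNonAssocRing B] [Module ℂ B] (hB : HasListedTable B) (h : Isomorphic A B) :
    HasListedTable A :=
  hB.imp fun _ hT => ⟨hT.1, h.trans hT.2⟩

section ChangeOfGenerator

open IsLocalRing PairAlgebra

variable {Q : Type*} [CommRing Q] {l r : Q}

theorem span_pair_mul_isUnit {u v : Q} (hu : IsUnit u) (hv : IsUnit v) :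
    Ideal.span {l * u, r * v} = Ideal.span {l, r} := by
  rw [Ideal.span_insert, Ideal.span_insert, Ideal.span_singleton_mul_right_unit hu,
    Ideal.span_singleton_mul_right_unit hv]

theorem isUnit_add_of_mem_maximalIdeal [IsLocalRing Q] {u q : Q} (hu : IsUnit u)
    (hq : q ∈ maximalIdeal Q) : IsUnit (u + q) := by
  by_contra h
  exact (mem_maximalIdeal _).1 ((Ideal.add_mem_iff_left _ hq).1 ((mem_maximalIdeal _).2 h)) hu

variable [Algebra ℂ Q]

theorem PairAlgebra.isomorphic_of_isUnit {c : ℂ} (hc : c ≠ 0) {p : Q}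
    (hu : IsUnit (algebraMap ℂ Q c + l * p)) (hv : IsUnit (algebraMap ℂ Q c + r * p)) :
    Isomorphic (PairAlgebra (l * (algebraMap ℂ Q c + r * p)) (r * (algebraMap ℂ Q c + l * p)))
      (PairAlgebra l r) := by
  let f : (ℂ × Q) ≃ₗ[ℂ] ℂ × Q := LinearEquiv.skewProd (LinearEquiv.smulOfNeZero ℂ ℂ c hc)
    (DistribMulAction.toLinearEquiv ℂ Q (hu.unit * hv.unit)) (LinearMap.toSpanSingleton ℂ Q p)
  refine ⟨f, fun x y => PairAlgebra.ext ?_ ?_⟩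
  · change c * 0 = 0
    exact mul_zero c
  · change (algebraMap ℂ Q c + l * p) * (algebraMap ℂ Q c + r * p) * (x * y).2 + (0 : ℂ) • p =
      (algebraMap ℂ Q (c * x.1) +
        r * ((algebraMap ℂ Q c + l * p) * (algebraMap ℂ Q c + r * p) * x.2 + x.1 • p)) *
      (algebraMap ℂ Q (c * y.1) +
        l * ((algebraMap ℂ Q c + l * p) * (algebraMap ℂ Q c + r * p) * y.2 + y.1 • p))
    simp only [Algebra.smul_def, map_mul, map_zero, snd_mul]
    ring

variable [IsLocalRing Q]

/-- Replacing the generator `(1, 0)` of `PairAlgebra l r` by `(c, p)`. -/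
theorem HasListedTable.of_change (hM : Ideal.span {l, r} = maximalIdeal Q) {c : ℂ} (hc : c ≠ 0)
    (p : Q) {l' r' : Q} (hl' : l' = l * (algebraMap ℂ Q c + r * p))
    (hr' : r' = r * (algebraMap ℂ Q c + l * p))
    (h : Ideal.span {l', r'} = maximalIdeal Q → HasListedTable (PairAlgebra l' r')) :
    HasListedTable (PairAlgebra l r) := by
  have hcu : IsUnit (algebraMap ℂ Q c) := hc.isUnit.map _
  have hu := isUnit_add_of_mem_maximalIdeal hcu (Ideal.mul_mem_right p _ (left_mem_maximalIdeal hM))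
  have hv := isUnit_add_of_mem_maximalIdeal hcu
    (Ideal.mul_mem_right p _ (right_mem_maximalIdeal hM))
  subst hl' hr'
  exact (h ((span_pair_mul_isUnit hv hu).trans hM)).of_isomorphic
    (isomorphic_of_isUnit hc hu hv).symm

end ChangeOfGenerator

section Uniserial

open IsLocalRing PairAlgebra Polynomial

variable {Q : Type*} [CommRing Q] [IsLocalRing Q]

theorem span_singleton_eq_maximalIdeal [IsNoetherianRing Q] {x : Q} (hx : x ∈ maximalIdeal Q)
    (h : maximalIdeal Q ≤ Ideal.span {x} ⊔ maximalIdeal Q ^ 2) :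
    Ideal.span {x} = maximalIdeal Q := by
  refine le_antisymm ((Ideal.span_singleton_le_iff_mem _).2 hx) ?_
  refine Submodule.le_of_le_smul_of_le_jacobson_bot (IsNoetherian.noetherian _)
    (maximalIdeal_le_jacobson ⊥) ?_
  rwa [smul_eq_mul, ← pow_two]

variable [Algebra ℂ Q]

theorem exists_change_eq_smul {x y z : Q} (hx : x ∈ maximalIdeal Q) {m : ℂ} (hm0 : m ≠ 0)
    (hm1 : m ≠ 1) (hy : y = m • x + x ^ 2 * z) :
    ∃ p, y * (1 + x * p) = m • (x * (1 + y * p)) := by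
  obtain ⟨p, hp⟩ := (((sub_ne_zero.2 hm1).isUnit.map (algebraMap ℂ Q)).mul
    (isUnit_add_of_mem_maximalIdeal (hm0.isUnit.map (algebraMap ℂ Q))
      (Ideal.mul_mem_right z _ hx))).dvd (a := z)
  refine ⟨p, ?_⟩
  rw [Algebra.smul_def] at hy ⊢
  rw [map_sub, map_one] at hp
  linear_combination (1 + x * p - algebraMap ℂ Q m * x * p) * hy + x ^ 2 * hp

variable [Module.Finite ℂ Q]

theorem eq_zero_or_eq_pow_mul_of_span_singleton {x : Q} (hx : Ideal.span {x} = maximalIdeal Q)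
    (z : Q) : z = 0 ∨ ∃ (k : ℕ) (u : Q), IsUnit u ∧ z = x ^ k * u := by
  refine or_iff_not_imp_left.2 fun hz => ?_
  have hxM : x ∈ maximalIdeal Q := hx ▸ Ideal.mem_span_singleton_self x
  have hfin : FiniteMultiplicity x z := by
    obtain ⟨n, hn⟩ := isNilpotent_maximalIdeal (Q := Q)
    have hxn : x ^ n = 0 := by simpa [hn] using Ideal.pow_mem_pow hxM n
    refine ⟨n, fun hdvd => hz ?_⟩
    rw [pow_succ, hxn, zero_mul, zero_dvd_iff] at hdvd
    exact hdvd
  obtain ⟨u, hzu, hu⟩ := hfin.exists_eq_pow_mul_and_not_dvd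
  refine ⟨_, u, ?_, hzu⟩
  rwa [← Ideal.mem_span_singleton, hx, mem_maximalIdeal, mem_nonunits_iff, not_not] at hu

theorem exists_eval_eq_zero_sub_mem_maximalIdeal {x : Q} {P : Q[X]}
    (hP : P.eval x ∈ maximalIdeal Q) (hP' : IsUnit (P.derivative.eval x)) :
    ∃ y, y - x ∈ maximalIdeal Q ∧ P.eval y = 0 := by
  obtain ⟨n, hn⟩ := isNilpotent_maximalIdeal (Q := Q)
  have hnil : IsNilpotent (P.eval x) := ⟨n, by simpa [hn] using Ideal.pow_mem_pow hP n⟩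
  obtain ⟨y, ⟨hyx, hy⟩, -⟩ := existsUnique_nilpotent_sub_and_aeval_eq_zero (x := x) (P := P)
    (by simpa using hnil) (by simpa using hP')
  refine ⟨y, ?_, by simpa using hy⟩
  rw [← neg_sub]
  exact neg_mem ((mem_maximalIdeal _).2 fun h => not_isUnit_zero <|
    let ⟨k, hk⟩ := hyx; hk ▸ h.pow k)

theorem exists_sub_algebraMap_pow_mem_maximalIdeal {u : Q} (hu : IsUnit u) {k : ℕ} (hk : k ≠ 0) :
    ∃ c : ℂ, c ≠ 0 ∧ u - algebraMap ℂ Q (c ^ k) ∈ maximalIdeal Q := by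
  obtain ⟨s, hs⟩ := exists_sub_algebraMap_mem_maximalIdeal u
  obtain ⟨c, rfl⟩ := IsAlgClosed.exists_pow_nat_eq s (Nat.pos_of_ne_zero hk)
  refine ⟨c, ?_, hs⟩
  rintro rfl
  rw [zero_pow hk, map_zero, sub_zero] at hs
  exact (mem_maximalIdeal _).1 hs hu

theorem finrank_maximalIdeal_pow_succ_lt {k : ℕ} (hk : maximalIdeal Q ^ k ≠ ⊥) :
    Module.finrank ℂ ((maximalIdeal Q ^ (k + 1)).restrictScalars ℂ) <
      Module.finrank ℂ ((maximalIdeal Q ^ k).restrictScalars ℂ) := by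
  have : IsNoetherianRing Q := isNoetherian_of_tower ℂ inferInstance
  refine Submodule.finrank_lt_finrank_of_lt <|
    lt_of_le_not_ge (Ideal.pow_le_pow_right k.le_succ) fun h => hk ?_
  refine Submodule.eq_bot_of_le_smul_of_le_jacobson_bot _ _ (IsNoetherian.noetherian _) ?_
    (maximalIdeal_le_jacobson ⊥)
  rwa [smul_eq_mul, ← pow_succ']

theorem maximalIdeal_pow_finrank : maximalIdeal Q ^ Module.finrank ℂ Q = ⊥ := by
  have hbound (k : ℕ) : maximalIdeal Q ^ k = ⊥ ∨
      Module.finrank ℂ ((maximalIdeal Q ^ k).restrictScalars ℂ) + k ≤ Module.finrank ℂ Q := by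
    induction k with
    | zero => exact .inr (Submodule.finrank_le _)
    | succ k ih =>
      by_cases hk : maximalIdeal Q ^ k = ⊥
      · exact .inl (by rw [pow_succ, hk, Ideal.bot_mul])
      · have hlt := finrank_maximalIdeal_pow_succ_lt hk
        exact .inr (by have := ih.resolve_left hk; omega)
  refine (hbound _).elim id fun h => ?_
  rw [← Submodule.restrictScalars_eq_bot_iff (S := ℂ), ← Submodule.finrank_eq_zero]
  omega

theorem exists_change_eq_pow {x y u : Q} (hy : Ideal.span {y} = maximalIdeal Q) (hu : IsUnit u)
    {n : ℕ} (hx : x = y ^ (n + 2) * u) : ∃ (c : ℂ) (p : Q), c ≠ 0 ∧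
      x * (algebraMap ℂ Q c + y * p) = (y * (algebraMap ℂ Q c + x * p)) ^ (n + 2) := by
  have hyM : y ∈ maximalIdeal Q := hy ▸ Ideal.mem_span_singleton_self y
  obtain ⟨c, hc, hcu⟩ := exists_sub_algebraMap_pow_mem_maximalIdeal hu n.succ_ne_zero
  set γ := algebraMap ℂ Q c
  -- The equation satisfied by `c + y p`, after cancelling `y ^ (n + 2)`.
  let P : Q[X] := C u * X - (C γ + C (y ^ (n + 1) * u) * (X - C γ)) ^ (n + 2)
  have hP : P.eval γ ∈ maximalIdeal Q := by
    convert Ideal.mul_mem_left _ γ hcu using 1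
    simp [P, γ]
    ring
  have hP' : IsUnit (P.derivative.eval γ) := by
    convert isUnit_add_of_mem_maximalIdeal hu
      (Ideal.mul_mem_right (-((n + 2) * γ ^ (n + 1) * y ^ n * u)) _ hyM) using 1
    simp [P, derivative_pow]
    ring
  obtain ⟨w, hw, hroot⟩ := exists_eval_eq_zero_sub_mem_maximalIdeal hP hP'
  rw [← hy, Ideal.mem_span_singleton'] at hw
  obtain ⟨p, hp⟩ := hw
  refine ⟨c, p, hc, ?_⟩
  obtain rfl : w = γ + y * p := by linear_combination -hp
  simp only [P, eval_sub, eval_mul, eval_pow, eval_add, eval_C, eval_X] at hroot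
  rw [add_sub_cancel_left] at hroot
  rw [mul_pow, show x * p = y ^ (n + 1) * u * (y * p) by rw [hx]; ring, hx]
  linear_combination y ^ (n + 2) * hroot

theorem exists_change_eq_add_pow {x y u : Q} (hx : Ideal.span {x} = maximalIdeal Q)
    (hu : IsUnit u) {n : ℕ} (hy : y = x + x ^ (n + 2) * u) : ∃ (c : ℂ) (p : Q), c ≠ 0 ∧
      y * (algebraMap ℂ Q c + x * p) =
        x * (algebraMap ℂ Q c + y * p) + (x * (algebraMap ℂ Q c + y * p)) ^ (n + 2) := by
  have hxM : x ∈ maximalIdeal Q := hx ▸ Ideal.mem_span_singleton_self x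
  have hyM : Ideal.span {y} = maximalIdeal Q := by
    rw [← hx, hy, ← Ideal.span_singleton_mul_right_unit (isUnit_add_of_mem_maximalIdeal isUnit_one
      (Ideal.mul_mem_right (x ^ n * u) _ hxM)) x]
    ring_nf
  obtain ⟨c, hc, hcu⟩ := exists_sub_algebraMap_pow_mem_maximalIdeal hu n.succ_ne_zero
  set γ := algebraMap ℂ Q c
  let P : Q[X] := X ^ (n + 2) - C (γ * u)
  have hP : P.eval γ ∈ maximalIdeal Q := by
    convert Ideal.mul_mem_left _ (-γ) hcu using 1
    simp [P, γ]
    ring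
  have hP' : IsUnit (P.derivative.eval γ) := by
    convert ((mul_ne_zero (Nat.cast_ne_zero.2 (n + 1).succ_ne_zero)
      (pow_ne_zero (n + 1) hc)).isUnit.map (algebraMap ℂ Q)) using 1
    simp [P, γ]
  obtain ⟨w, hw, hroot⟩ := exists_eval_eq_zero_sub_mem_maximalIdeal hP hP'
  rw [← hyM, Ideal.mem_span_singleton'] at hw
  obtain ⟨p, hp⟩ := hw
  refine ⟨c, p, hc, ?_⟩
  obtain rfl : w = γ + y * p := by linear_combination -hp
  simp only [P, eval_sub, eval_pow, eval_C, eval_X] at hroot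
  rw [mul_pow]
  linear_combination γ * hy - x ^ (n + 2) * hroot

end Uniserial

section CyclicMaximalIdeal

open IsLocalRing PairAlgebra

variable {Q : Type*} [CommRing Q] [IsLocalRing Q] [Algebra ℂ Q] [Module.Finite ℂ Q] {l r : Q}

theorem pow_five_eq_zero (hQ : Module.finrank ℂ Q = 5) {x : Q} (hx : x ∈ maximalIdeal Q) :
    x ^ 5 = 0 := by
  simpa [← hQ, maximalIdeal_pow_finrank] using Ideal.pow_mem_pow hx 5

theorem eq_zero_or_eq_pow_mul_of_dvd (hQ : Module.finrank ℂ Q = 5) {x y : Q}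
    (hx : Ideal.span {x} = maximalIdeal Q) (hy : x ^ 2 ∣ y) :
    y = 0 ∨ ∃ (n : ℕ) (u : Q), n < 3 ∧ IsUnit u ∧ y = x ^ (n + 2) * u := by
  obtain ⟨z, rfl⟩ := hy
  obtain rfl | ⟨n, u, hu, rfl⟩ := eq_zero_or_eq_pow_mul_of_span_singleton hx z
  · exact .inl (mul_zero _)
  · rw [← mul_assoc, ← pow_add, add_comm 2]
    obtain hn | hn := lt_or_ge n 3
    · exact .inr ⟨n, u, hn, hu, rfl⟩
    · have hx5 := pow_five_eq_zero hQ (hx ▸ Ideal.mem_span_singleton_self x)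
      exact .inl (by rw [pow_eq_zero_of_le (by omega) hx5, zero_mul])

theorem hasListedTable_of_left_mem_sq (hQ : Module.finrank ℂ Q = 5)
    (hM : Ideal.span {l, r} = maximalIdeal Q) (hl : l ∈ maximalIdeal Q ^ 2) :
    HasListedTable (PairAlgebra l r) := by
  have hrM := right_mem_maximalIdeal hM
  have : IsNoetherianRing Q := isNoetherian_of_tower ℂ inferInstance
  have hr : Ideal.span {r} = maximalIdeal Q := by
    refine span_singleton_eq_maximalIdeal hrM ?_
    nth_rw 1 [← hM]
    rw [Ideal.span_insert, sup_comm]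
    exact sup_le_sup_left ((Ideal.span_singleton_le_iff_mem _).2 hl) _
  have hdvd : r ^ 2 ∣ l := by
    rwa [← hr, Ideal.span_singleton_pow, Ideal.mem_span_singleton] at hl
  obtain rfl | ⟨n, u, hn, hu, hlr⟩ := eq_zero_or_eq_pow_mul_of_dvd hQ hr hdvd
  · exact ⟨_, .b22, isomorphic_B22 hQ hM (pow_five_eq_zero hQ hrM)⟩
  · obtain ⟨c, p, hc, hcp⟩ := exists_change_eq_pow hr hu hlr
    refine .of_change hM hc p hcp.symm rfl fun hM' => ?_
    have hr5 := pow_five_eq_zero hQ (right_mem_maximalIdeal hM')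
    interval_cases n
    · exact ⟨_, .b19, isomorphic_B19 hQ hM' hr5⟩
    · exact ⟨_, .b20, isomorphic_B20 hQ hM' hr5⟩
    · exact ⟨_, .b21, isomorphic_B21 hQ hM' hr5⟩

theorem hasListedTable_of_sq_dvd (hQ : Module.finrank ℂ Q = 5)
    (hl : Ideal.span {l} = maximalIdeal Q) (hM : Ideal.span {l, r} = maximalIdeal Q)
    (hr : l ^ 2 ∣ r) : HasListedTable (PairAlgebra l r) := by
  obtain rfl | ⟨n, u, hn, hu, hrl⟩ := eq_zero_or_eq_pow_mul_of_dvd hQ hl hr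
  · have hl5 := pow_five_eq_zero hQ (hl ▸ Ideal.mem_span_singleton_self l)
    rw [← zero_smul ℂ l] at hM ⊢
    exact ⟨_, .b25 0, isomorphic_B25 hQ hM hl5⟩
  · obtain ⟨c, p, hc, hcp⟩ := exists_change_eq_pow hl hu hrl
    refine .of_change hM hc p rfl hcp.symm fun hM' => ?_
    have hl5 := pow_five_eq_zero hQ (left_mem_maximalIdeal hM')
    interval_cases n
    · exact ⟨_, .b23, isomorphic_B23 hQ hM' hl5⟩
    · exact ⟨_, .b28, isomorphic_B28 hQ hM' hl5⟩
    · exact ⟨_, .b26, isomorphic_B26 hQ hM' hl5⟩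

theorem hasListedTable_of_sq_dvd_sub (hQ : Module.finrank ℂ Q = 5)
    (hl : Ideal.span {l} = maximalIdeal Q) (hM : Ideal.span {l, r} = maximalIdeal Q)
    (hr : l ^ 2 ∣ r - l) : HasListedTable (PairAlgebra l r) := by
  obtain h | ⟨n, u, hn, hu, hrl⟩ := eq_zero_or_eq_pow_mul_of_dvd hQ hl hr
  · have hl5 := pow_five_eq_zero hQ (hl ▸ Ideal.mem_span_singleton_self l)
    obtain rfl : r = (1 : ℂ) • l := by rw [one_smul, ← sub_eq_zero, h]
    exact ⟨_, .b25 1, isomorphic_B25 hQ hM hl5⟩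
  · obtain ⟨c, p, hc, hcp⟩ := exists_change_eq_add_pow hl hu (eq_add_of_sub_eq' hrl)
    refine .of_change hM hc p rfl hcp.symm fun hM' => ?_
    have hl5 := pow_five_eq_zero hQ (left_mem_maximalIdeal hM')
    interval_cases n
    · exact ⟨_, .b24, isomorphic_B24 hQ hM' hl5⟩
    · exact ⟨_, .b29, isomorphic_B29 hQ hM' hl5⟩
    · exact ⟨_, .b27, isomorphic_B27 hQ hM' hl5⟩

theorem hasListedTable_of_sub_smul_mem_sq (hQ : Module.finrank ℂ Q = 5)
    (hM : Ideal.span {l, r} = maximalIdeal Q) {m : ℂ} (hr : r - m • l ∈ maximalIdeal Q ^ 2) :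
    HasListedTable (PairAlgebra l r) := by
  have hlM := left_mem_maximalIdeal hM
  have : IsNoetherianRing Q := isNoetherian_of_tower ℂ inferInstance
  have hl : Ideal.span {l} = maximalIdeal Q := by
    refine span_singleton_eq_maximalIdeal hlM ?_
    nth_rw 1 [← hM]
    refine Ideal.span_le.2 (Set.pair_subset ?_ ?_)
    · exact Ideal.mem_sup_left (Ideal.mem_span_singleton_self l)
    · rw [SetLike.mem_coe, ← add_sub_cancel (m • l) r]
      exact add_mem (Ideal.mem_sup_left (Submodule.smul_of_tower_mem _ m
        (Ideal.mem_span_singleton_self l))) (Ideal.mem_sup_right hr)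
  have hdvd : l ^ 2 ∣ r - m • l := by
    rwa [← hl, Ideal.span_singleton_pow, Ideal.mem_span_singleton] at hr
  obtain rfl | hm0 := eq_or_ne m 0
  · exact hasListedTable_of_sq_dvd hQ hl hM (by simpa using hdvd)
  obtain rfl | hm1 := eq_or_ne m 1
  · exact hasListedTable_of_sq_dvd_sub hQ hl hM (by simpa using hdvd)
  obtain ⟨z, hz⟩ := hdvd
  obtain ⟨p, hp⟩ := exists_change_eq_smul hlM hm0 hm1 (eq_add_of_sub_eq' hz)
  rw [← map_one (algebraMap ℂ Q)] at hp
  refine .of_change hM one_ne_zero p rfl hp.symm fun hM' => ?_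
  exact ⟨_, .b25 m, isomorphic_B25 hQ hM' <|
    pow_five_eq_zero hQ (left_mem_maximalIdeal hM')⟩

end CyclicMaximalIdeal

section LinearAlgebra

variable {K E : Type*} [Field K] [AddCommGroup E] [Module K E]

theorem exists_smul_add_smul_add_smul_eq_zero {V : Submodule K E} [Module.Finite K V]
    (hV : Module.finrank K V ≤ 2) {x y z : E} (hx : x ∈ V) (hy : y ∈ V) (hz : z ∈ V) :
    ∃ a b c : K, (a ≠ 0 ∨ b ≠ 0 ∨ c ≠ 0) ∧ a • x + b • y + c • z = 0 := by
  have hdep : ¬ LinearIndependent K ![(⟨x, hx⟩ : V), ⟨y, hy⟩, ⟨z, hz⟩] := fun h => by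
    simpa using h.fintype_card_le_finrank.trans hV
  obtain ⟨g, hg, i, hi⟩ := Fintype.not_linearIndependent_iff.mp hdep
  refine ⟨g 0, g 1, g 2, ?_, by simpa [Fin.sum_univ_three] using congrArg Subtype.val hg⟩
  fin_cases i <;> simp_all

theorem exists_sub_smul_mem {V W : Submodule K E} [Module.Finite K W]
    (hVW : V ≤ W) (hdim : Module.finrank K W ≤ Module.finrank K V + 1) {t : E} (htW : t ∈ W)
    (htV : t ∉ V) {z : E} (hz : z ∈ W) : ∃ a : K, z - a • t ∈ V := by
  have : Module.Finite K (V ⊔ K ∙ t : Submodule K E) :=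
    Submodule.finiteDimensional_of_le (sup_le hVW ((Submodule.span_singleton_le_iff_mem _ _).2 htW))
  have hsup : V ⊔ K ∙ t = W := by
    refine Submodule.eq_of_le_of_finrank_le
      (sup_le hVW ((Submodule.span_singleton_le_iff_mem _ _).2 htW)) (hdim.trans ?_)
    exact Submodule.finrank_lt_finrank_of_lt <| left_lt_sup.2 fun h =>
      htV (h (Submodule.mem_span_singleton_self t))
  rw [← hsup, Submodule.mem_sup] at hz
  obtain ⟨v, hv, w, hw, rfl⟩ := hz
  obtain ⟨a, rfl⟩ := Submodule.mem_span_singleton.1 hw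
  exact ⟨a, by rwa [add_sub_cancel_right]⟩

end LinearAlgebra

section NoncyclicMaximalIdeal

open IsLocalRing PairAlgebra

variable {Q : Type*} [CommRing Q] [IsLocalRing Q] [Algebra ℂ Q] [Module.Finite ℂ Q] {l r : Q}

theorem hasListedTable_of_quadratic_relation (hQ : Module.finrank ℂ Q = 5)
    (hM : Ideal.span {l, r} = maximalIdeal Q) (hM3 : maximalIdeal Q ^ 3 = ⊥) {a b c : ℂ}
    (habc : a ≠ 0 ∨ b ≠ 0 ∨ c ≠ 0) (hrel : a • l ^ 2 + b • (l * r) + c • r ^ 2 = 0) :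
    HasListedTable (PairAlgebra l r) := by
  have hcube {x y z : Q} (hx : x ∈ maximalIdeal Q) (hy : y ∈ maximalIdeal Q)
      (hz : z ∈ maximalIdeal Q) : x * y * z = 0 := by
    rw [← Ideal.mem_bot, ← hM3, pow_three']
    exact Ideal.mul_mem_mul (Ideal.mul_mem_mul hx hy) hz
  have hl := left_mem_maximalIdeal hM
  have hr := right_mem_maximalIdeal hM
  have hlll : l ^ 3 = 0 := by rw [pow_three', hcube hl hl hl]
  have hllr : l ^ 2 * r = 0 := by rw [pow_two, hcube hl hl hr]
  have hlrr : l * r ^ 2 = 0 := by rw [pow_two, ← mul_assoc, hcube hl hr hr]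
  have hrrr : r ^ 3 = 0 := by rw [pow_three', hcube hr hr hr]
  by_cases ha : a = 0
  · by_cases hc : c = 0
    · simp_all only [ne_eq, not_true_eq_false, or_false, false_or, zero_smul, zero_add, add_zero,
        smul_eq_zero, false_or]
      exact ⟨_, .b01, isomorphic_B01 hQ hM hrel hlll hrrr⟩
    · refine ⟨_, .b02 (-(c⁻¹ * b)), isomorphic_B02 hQ hM ?_ hlll hllr hlrr⟩
      linear_combination (norm := (match_scalars <;> field_simp <;> simp [ha])) c⁻¹ • hrel
  · refine ⟨_, .b03 (-(a⁻¹ * c)) (-(a⁻¹ * b)), isomorphic_B03 hQ hM ?_ hllr hlrr hrrr⟩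
    linear_combination (norm := (match_scalars <;> field_simp <;> ring)) a⁻¹ • hrel

theorem hasListedTable_of_sq_eq_smul_right_cube (hQ : Module.finrank ℂ Q = 5)
    (hM : Ideal.span {l, r} = maximalIdeal Q) {a b : ℂ} (hl : l ^ 2 = a • r ^ 3)
    (hlr : l * r = b • r ^ 3) (hr : r ^ 4 = 0) : HasListedTable (PairAlgebra l r) := by
  rw [Algebra.smul_def] at hl hlr
  obtain rfl | hb := eq_or_ne b 0
  · rw [map_zero, zero_mul] at hlr
    obtain rfl | ha := eq_or_ne a 0
    · rw [map_zero, zero_mul] at hl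
      exact ⟨_, .b11, isomorphic_B11 hQ hM hlr hl hr⟩
    · refine .of_change hM ha 0 rfl rfl fun hM' => ⟨_, .b10, isomorphic_B10 hQ hM' ?_ ?_⟩
      · linear_combination algebraMap ℂ Q a ^ 2 * hlr
      · linear_combination algebraMap ℂ Q a ^ 2 * hl
  · refine .of_change hM hb 0 rfl rfl fun hM' => ⟨_, .b09 (a / b), isomorphic_B09 hQ hM' ?_ ?_ ?_⟩
    · linear_combination algebraMap ℂ Q b ^ 2 * hlr
    · have hab : algebraMap ℂ Q (a / b) * algebraMap ℂ Q b = algebraMap ℂ Q a := by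
        rw [← map_mul, div_mul_cancel₀ _ hb]
      rw [Algebra.smul_def]
      linear_combination algebraMap ℂ Q b ^ 2 * hl - algebraMap ℂ Q b ^ 2 * r ^ 3 * hab
    · rw [mul_pow, hr, zero_mul]

theorem hasListedTable_of_mul_eq_smul_sq (hQ : Module.finrank ℂ Q = 5)
    (hM : Ideal.span {l, r} = maximalIdeal Q) {m b : ℂ} (hlr : l * r = m • l ^ 2)
    (hr : r ^ 2 = m • (l * r) + b • l ^ 3) (hl : l ^ 4 = 0) :
    HasListedTable (PairAlgebra l r) := by
  obtain rfl | hb := eq_or_ne b 0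
  · rw [zero_smul, add_zero] at hr
    exact ⟨_, .b12 m, isomorphic_B12 hQ hM hlr hr hl⟩
  · rw [Algebra.smul_def] at hlr
    rw [Algebra.smul_def, Algebra.smul_def] at hr
    refine .of_change hM hb 0 rfl rfl fun hM' => ⟨_, .b13 m, isomorphic_B13 hQ hM' ?_ ?_ ?_⟩
    · rw [Algebra.smul_def]
      linear_combination algebraMap ℂ Q b ^ 2 * hlr
    · rw [Algebra.smul_def]
      linear_combination algebraMap ℂ Q b ^ 2 * hr
    · rw [mul_pow, hl, zero_mul]

/-- For `m ≠ 0, 1` the generator `(1, t)` with `a + t m (1 - m) = 0` removes the term `a l³`. -/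
theorem hasListedTable_of_mul_eq_smul_sq_add (hQ : Module.finrank ℂ Q = 5)
    (hM : Ideal.span {l, r} = maximalIdeal Q) {m a b : ℂ} (hm0 : m ≠ 0) (hm1 : m ≠ 1)
    (hlr : l * r = m • l ^ 2 + a • l ^ 3) (hr : r ^ 2 = m • (l * r) + b • l ^ 3)
    (hl : l ^ 4 = 0) : HasListedTable (PairAlgebra l r) := by
  obtain ⟨t, ht⟩ : ∃ t : ℂ, a + t * m * (1 - m) = 0 := by
    have := sub_ne_zero.2 hm1.symm
    exact ⟨-a / (m * (1 - m)), by field_simp; ring⟩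
  replace ht := congrArg (algebraMap ℂ Q) ht
  refine .of_change hM one_ne_zero (algebraMap ℂ Q t) rfl rfl fun hM' =>
    hasListedTable_of_mul_eq_smul_sq hQ hM' (m := m) (b := b - a * m) ?_ ?_
      (by rw [mul_pow, hl, zero_mul])
  all_goals
    simp only [Algebra.smul_def, map_one, map_add, map_mul, map_sub, map_zero] at hlr hr ht ⊢
    generalize algebraMap ℂ Q t = t, algebraMap ℂ Q m = m, algebraMap ℂ Q a = a,
      algebraMap ℂ Q b = b at *
    have hllr : l ^ 2 * r = m * l ^ 3 := by linear_combination l * hlr + a * hl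
    have hlrr : l * r ^ 2 = m ^ 2 * l ^ 3 := by
      linear_combination l * hr + m * hllr + b * hl
    have hllrr : l ^ 2 * r ^ 2 = 0 := by linear_combination l * hlrr + m ^ 2 * hl
  · linear_combination hlr + t * hllr + t * hlrr + t ^ 2 * hllrr - 2 * m * t * hllr -
      m * t ^ 2 * hllrr + l ^ 3 * ht
  · have hlll : l ^ 3 * (1 + r * t) ^ 3 = l ^ 3 := by
      linear_combination (3 * t * l + 3 * t ^ 2 * l * r + t ^ 3 * l * r ^ 2) * hllr +
        m * (3 * t + 3 * t ^ 2 * r + t ^ 3 * r ^ 2) * hl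
    rw [mul_pow l, hlll]
    linear_combination hr + 2 * t * hlrr + t ^ 2 * hllrr - m * t * hllr - m * t * hlrr -
      m * t ^ 2 * hllrr + m * l ^ 3 * ht

theorem hasListedTable_of_sub_eq_smul_left_cube (hQ : Module.finrank ℂ Q = 5)
    (hM : Ideal.span {l, r} = maximalIdeal Q) {m a b : ℂ}
    (hlr : l * r = m • l ^ 2 + a • l ^ 3) (hr : r ^ 2 = m • (l * r) + b • l ^ 3)
    (hl : l ^ 4 = 0) : HasListedTable (PairAlgebra l r) := by
  obtain rfl | ha := eq_or_ne a 0
  · exact hasListedTable_of_mul_eq_smul_sq hQ hM (by rw [hlr, zero_smul, add_zero]) hr hl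
  have hab : algebraMap ℂ Q (b / a) * algebraMap ℂ Q a = algebraMap ℂ Q b := by
    rw [← map_mul, div_mul_cancel₀ _ ha]
  have hl' : (l * (algebraMap ℂ Q a + r * 0)) ^ 4 = 0 := by rw [mul_pow, hl, zero_mul]
  obtain rfl | hm0 := eq_or_ne m 0
  · simp only [Algebra.smul_def, map_zero, zero_mul, zero_add] at hlr hr
    refine .of_change hM ha 0 rfl rfl fun hM' =>
      ⟨_, .b14 (b / a), isomorphic_B14 hQ hM' ?_ ?_ hl'⟩
    · linear_combination algebraMap ℂ Q a ^ 2 * hlr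
    · rw [Algebra.smul_def]
      linear_combination algebraMap ℂ Q a ^ 2 * hr - algebraMap ℂ Q a ^ 2 * l ^ 3 * hab
  obtain rfl | hm1 := eq_or_ne m 1
  · simp only [Algebra.smul_def, map_one, one_mul] at hlr hr
    refine .of_change hM ha 0 rfl rfl fun hM' =>
      ⟨_, .b15 (b / a), isomorphic_B15 hQ hM' ?_ ?_ hl'⟩
    · linear_combination algebraMap ℂ Q a ^ 2 * hlr
    · rw [Algebra.smul_def]
      linear_combination algebraMap ℂ Q a ^ 2 * hr - algebraMap ℂ Q a ^ 2 * l ^ 3 * hab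
  · exact hasListedTable_of_mul_eq_smul_sq_add hQ hM hm0 hm1 hlr hr hl

end NoncyclicMaximalIdeal

section CubicMaximalIdeal

open IsLocalRing PairAlgebra

variable {Q : Type*} [CommRing Q] [IsLocalRing Q] [Algebra ℂ Q] [Module.Finite ℂ Q] {l r : Q}

theorem exists_sub_smul_mem_maximalIdeal_pow {k : ℕ}
    (hdim : Module.finrank ℂ ((maximalIdeal Q ^ k).restrictScalars ℂ) ≤
      Module.finrank ℂ ((maximalIdeal Q ^ (k + 1)).restrictScalars ℂ) + 1)
    {t z : Q} (ht : t ∈ maximalIdeal Q ^ k) (ht' : t ∉ maximalIdeal Q ^ (k + 1))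
    (hz : z ∈ maximalIdeal Q ^ k) : ∃ a : ℂ, z - a • t ∈ maximalIdeal Q ^ (k + 1) :=
  exists_sub_smul_mem (V := (maximalIdeal Q ^ (k + 1)).restrictScalars ℂ)
    (W := (maximalIdeal Q ^ k).restrictScalars ℂ) (Ideal.pow_le_pow_right k.le_succ) hdim ht ht' hz

theorem mem_maximalIdeal_pow_succ_of_mul_eq_zero {k : ℕ}
    (hdim : Module.finrank ℂ ((maximalIdeal Q ^ k).restrictScalars ℂ) ≤
      Module.finrank ℂ ((maximalIdeal Q ^ (k + 1)).restrictScalars ℂ) + 1)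
    (hk : maximalIdeal Q ^ (k + 1) ≠ ⊥) (hk' : maximalIdeal Q ^ (k + 2) = ⊥) {y : Q}
    (hy : y ∈ maximalIdeal Q ^ k) (hMy : ∀ z ∈ maximalIdeal Q, z * y = 0) :
    y ∈ maximalIdeal Q ^ (k + 1) := by
  by_contra hy'
  refine hk (le_bot_iff.1 ?_)
  rw [pow_succ', Ideal.mul_le]
  intro z hz w hw
  obtain ⟨a, ha⟩ := exists_sub_smul_mem_maximalIdeal_pow hdim hy hy' hw
  have hzw := Ideal.mul_mem_mul hz ha
  rwa [← pow_succ', hk', mul_sub, mul_smul_comm, hMy z hz, smul_zero, sub_zero] at hzw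

theorem forall_mul_eq_zero_or_exists_smul_mul_eq_zero {k : ℕ}
    (hdim : Module.finrank ℂ ((maximalIdeal Q ^ k).restrictScalars ℂ) ≤
      Module.finrank ℂ ((maximalIdeal Q ^ (k + 1)).restrictScalars ℂ) + 1)
    (hdim' : Module.finrank ℂ ((maximalIdeal Q ^ (k + 1)).restrictScalars ℂ) ≤ 1)
    (hk : maximalIdeal Q ^ (k + 2) = ⊥) (hl : l ∈ maximalIdeal Q) (hr : r ∈ maximalIdeal Q) :
    (∀ y ∈ maximalIdeal Q ^ k, l * y = 0) ∨
      ∃ m : ℂ, ∀ y ∈ maximalIdeal Q ^ k, (r - m • l) * y = 0 := by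
  have hzero {x y : Q} (hx : x ∈ maximalIdeal Q) (hy : y ∈ maximalIdeal Q ^ (k + 1)) :
      x * y = 0 := by
    rw [← Ideal.mem_bot, ← hk, pow_succ']
    exact Ideal.mul_mem_mul hx hy
  refine or_iff_not_imp_left.2 fun h => ?_
  push Not at h
  obtain ⟨t, ht, hlt⟩ := h
  have ht' : t ∉ maximalIdeal Q ^ (k + 1) := fun h => hlt (hzero hl h)
  have hmem {x : Q} (hx : x ∈ maximalIdeal Q) : x * t ∈ maximalIdeal Q ^ (k + 1) :=
    pow_succ' (maximalIdeal Q) k ▸ Ideal.mul_mem_mul hx ht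
  obtain ⟨m, hm⟩ := exists_sub_smul_mem (W := (maximalIdeal Q ^ (k + 1)).restrictScalars ℂ) bot_le
    (by rwa [finrank_bot]) (hmem hl) hlt (hmem hr)
  have hmt : (r - m • l) * t = 0 := by
    rw [sub_mul, smul_mul_assoc]
    exact (Submodule.mem_bot _).1 hm
  refine ⟨m, fun y hy => ?_⟩
  obtain ⟨a, ha⟩ := exists_sub_smul_mem_maximalIdeal_pow hdim ht ht' hy
  rw [← sub_add_cancel y (a • t), mul_add, mul_smul_comm, hmt, smul_zero, add_zero]
  exact hzero (sub_mem hr (Submodule.smul_of_tower_mem _ m hl)) ha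

theorem exists_eq_smul_cube {x e : Q} (hM : Ideal.span {x, e} = maximalIdeal Q)
    (he : ∀ y ∈ maximalIdeal Q ^ 2, e * y = 0) (hM4 : maximalIdeal Q ^ 4 = ⊥) {z : Q}
    (hz : z ∈ maximalIdeal Q ^ 3) : ∃ a : ℂ, z = a • x ^ 3 := by
  have hxM := left_mem_maximalIdeal hM
  have hmul {I : Ideal Q} (hI : I ≤ maximalIdeal Q ^ 2) :
      I * maximalIdeal Q = I * Ideal.span {x} := by
    nth_rw 1 [← hM]
    rw [Ideal.span_insert, Ideal.mul_sup, sup_eq_left, Ideal.mul_le]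
    intro y hy w hw
    obtain ⟨q, rfl⟩ := Ideal.mem_span_singleton'.1 hw
    rw [mul_left_comm, mul_comm y, he y (hI hy), mul_zero]
    exact zero_mem _
  have hx : Ideal.span {x} ≤ maximalIdeal Q := (Ideal.span_singleton_le_iff_mem _).2 hxM
  have hcube : maximalIdeal Q ^ 3 = Ideal.span {x ^ 3} := by
    rw [← Ideal.span_singleton_pow, pow_succ, hmul le_rfl, pow_two, mul_right_comm, hmul,
      mul_assoc, mul_comm, hmul, pow_three']
    · exact pow_two (maximalIdeal Q) ▸ Ideal.mul_mono hx hx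
    · exact pow_two (maximalIdeal Q) ▸ Ideal.mul_mono_right hx
  rw [hcube, Ideal.mem_span_singleton'] at hz
  obtain ⟨q, rfl⟩ := hz
  obtain ⟨a, ha⟩ := exists_sub_algebraMap_mem_maximalIdeal q
  refine ⟨a, ?_⟩
  have hzero := Ideal.mul_mem_mul ha (Ideal.pow_mem_pow hxM 3)
  rw [← pow_succ', hM4, Ideal.mem_bot, sub_mul, sub_eq_zero] at hzero
  rw [hzero, Algebra.smul_def]

theorem exists_mul_eq_smul_cube
    (hdim : Module.finrank ℂ ((maximalIdeal Q ^ 2).restrictScalars ℂ) ≤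
      Module.finrank ℂ ((maximalIdeal Q ^ 3).restrictScalars ℂ) + 1)
    (hM3 : maximalIdeal Q ^ 3 ≠ ⊥) (hM4 : maximalIdeal Q ^ 4 = ⊥) {x e : Q}
    (hM : Ideal.span {x, e} = maximalIdeal Q) (he : ∀ y ∈ maximalIdeal Q ^ 2, e * y = 0) {z : Q}
    (hz : z ∈ maximalIdeal Q) : ∃ a : ℂ, z * e = a • x ^ 3 := by
  refine exists_eq_smul_cube hM he hM4 <|
    mem_maximalIdeal_pow_succ_of_mul_eq_zero hdim hM3 hM4 ?_ fun w hw => ?_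
  · exact pow_two (maximalIdeal Q) ▸ Ideal.mul_mem_mul hz (right_mem_maximalIdeal hM)
  · rw [← mul_assoc, mul_comm]
    exact he _ (pow_two (maximalIdeal Q) ▸ Ideal.mul_mem_mul hw hz)

theorem hasListedTable_of_cube_ne_bot (hQ : Module.finrank ℂ Q = 5)
    (hM : Ideal.span {l, r} = maximalIdeal Q)
    (hdim : Module.finrank ℂ ((maximalIdeal Q ^ 2).restrictScalars ℂ) ≤
      Module.finrank ℂ ((maximalIdeal Q ^ 3).restrictScalars ℂ) + 1)
    (hdim' : Module.finrank ℂ ((maximalIdeal Q ^ 3).restrictScalars ℂ) ≤ 1)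
    (hM3 : maximalIdeal Q ^ 3 ≠ ⊥) (hM4 : maximalIdeal Q ^ 4 = ⊥) :
    HasListedTable (PairAlgebra l r) := by
  have hl := left_mem_maximalIdeal hM
  have hr := right_mem_maximalIdeal hM
  have hpow {x : Q} (hx : x ∈ maximalIdeal Q) : x ^ 4 = 0 := by
    simpa [hM4] using Ideal.pow_mem_pow hx 4
  obtain he | ⟨m, he⟩ := forall_mul_eq_zero_or_exists_smul_mul_eq_zero hdim hdim' hM4 hl hr
  · have hM' := Ideal.span_pair_comm.trans hM
    obtain ⟨a, ha⟩ := exists_mul_eq_smul_cube hdim hM3 hM4 hM' he hl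
    obtain ⟨b, hb⟩ := exists_mul_eq_smul_cube hdim hM3 hM4 hM' he hr
    exact hasListedTable_of_sq_eq_smul_right_cube hQ hM (by rw [pow_two, ha])
      (by rw [mul_comm, hb]) (hpow hr)
  · have hM' : Ideal.span {l, r - m • l} = maximalIdeal Q := by
      rw [← hM, Algebra.smul_def, Ideal.span_pair_sub_mul_left]
    obtain ⟨a, ha⟩ := exists_mul_eq_smul_cube hdim hM3 hM4 hM' he hl
    obtain ⟨b, hb⟩ := exists_mul_eq_smul_cube hdim hM3 hM4 hM' he hr
    rw [mul_sub, mul_smul_comm, sub_eq_iff_eq_add', ← pow_two] at ha hb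
    exact hasListedTable_of_sub_eq_smul_left_cube hQ hM ha (by rw [hb, mul_comm r]) (hpow hl)

theorem finrank_maximalIdeal_sq_add_three_le (hM : Ideal.span {l, r} = maximalIdeal Q)
    (hl : l ∉ maximalIdeal Q ^ 2) (hr : ∀ m : ℂ, r - m • l ∉ maximalIdeal Q ^ 2) :
    Module.finrank ℂ ((maximalIdeal Q ^ 2).restrictScalars ℂ) + 3 ≤ Module.finrank ℂ Q := by
  set M := (maximalIdeal Q).restrictScalars ℂ
  set M2 := (maximalIdeal Q ^ 2).restrictScalars ℂ
  have hlt₁ : M2 < M2 ⊔ ℂ ∙ l := left_lt_sup.2 fun h => hl (h (Submodule.mem_span_singleton_self l))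
  have hlt₂ : M2 ⊔ ℂ ∙ l < M := by
    refine lt_of_le_of_ne (sup_le (fun _ hx => Ideal.pow_le_self two_ne_zero hx)
      ((Submodule.span_singleton_le_iff_mem _ _).2 (left_mem_maximalIdeal hM))) fun h => ?_
    obtain ⟨v, hv, w, hw, hvw⟩ := Submodule.mem_sup.1 (h ▸ right_mem_maximalIdeal hM :
      r ∈ M2 ⊔ ℂ ∙ l)
    obtain ⟨m, rfl⟩ := Submodule.mem_span_singleton.1 hw
    exact hr m (by rwa [← hvw, add_sub_cancel_right])
  have hlt₃ : M ≠ ⊤ := fun h =>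
    (Ideal.ne_top_iff_one _).1 (maximalIdeal.isMaximal Q).ne_top (h ▸ trivial : (1 : Q) ∈ M)
  have h₁ := Submodule.finrank_lt_finrank_of_lt hlt₁
  have h₂ := Submodule.finrank_lt_finrank_of_lt hlt₂
  have h₃ := Submodule.finrank_lt hlt₃
  omega

theorem hasListedTable_pairAlgebra (hQ : Module.finrank ℂ Q = 5)
    (hM : Ideal.span {l, r} = maximalIdeal Q) : HasListedTable (PairAlgebra l r) := by
  by_cases hl : l ∈ maximalIdeal Q ^ 2
  · exact hasListedTable_of_left_mem_sq hQ hM hl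
  by_cases hr : ∃ m : ℂ, r - m • l ∈ maximalIdeal Q ^ 2
  · exact hr.elim fun m => hasListedTable_of_sub_smul_mem_sq hQ hM
  have hdim2 := finrank_maximalIdeal_sq_add_three_le hM hl (not_exists.1 hr)
  by_cases hM3 : maximalIdeal Q ^ 3 = ⊥
  · have hsq {x y : Q} (hx : x ∈ maximalIdeal Q) (hy : y ∈ maximalIdeal Q) :
        x * y ∈ (maximalIdeal Q ^ 2).restrictScalars ℂ :=
      pow_two (maximalIdeal Q) ▸ Ideal.mul_mem_mul hx hy
    have hlM := left_mem_maximalIdeal hM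
    have hrM := right_mem_maximalIdeal hM
    obtain ⟨a, b, c, habc, hrel⟩ := exists_smul_add_smul_add_smul_eq_zero (by omega)
      (hsq hlM hlM) (hsq hlM hrM) (hsq hrM hrM)
    rw [← pow_two, ← pow_two] at hrel
    exact hasListedTable_of_quadratic_relation hQ hM hM3 habc hrel
  · have hM2 : maximalIdeal Q ^ 2 ≠ ⊥ := fun h => hM3 (by rw [pow_succ, h, Ideal.bot_mul])
    have hlt2 : Module.finrank ℂ ((maximalIdeal Q ^ 3).restrictScalars ℂ) <
      Module.finrank ℂ ((maximalIdeal Q ^ 2).restrictScalars ℂ) :=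
        finrank_maximalIdeal_pow_succ_lt hM2
    have hlt3 : Module.finrank ℂ ((maximalIdeal Q ^ 4).restrictScalars ℂ) <
      Module.finrank ℂ ((maximalIdeal Q ^ 3).restrictScalars ℂ) :=
        finrank_maximalIdeal_pow_succ_lt hM3
    have hM4 : maximalIdeal Q ^ 4 = ⊥ := by
      rw [← Submodule.restrictScalars_eq_bot_iff (S := ℂ), ← Submodule.finrank_eq_zero]
      omega
    exact hasListedTable_of_cube_ne_bot hQ hM (by omega) (by omega) hM3 hM4

end CubicMaximalIdeal

section LocalOfNilpotentGenerators

open IsLocalRing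

variable {K R : Type*} [Field K] [CommRing R] [Algebra K R] {s : Set R}

theorem exists_sub_algebraMap_mem_span (hs : Algebra.adjoin K s = ⊤) (x : R) :
    ∃ c : K, x - algebraMap K R c ∈ Ideal.span s := by
  have hx : x ∈ Algebra.adjoin K s := hs ▸ Algebra.mem_top
  induction hx using Algebra.adjoin_induction with
  | mem x hx => exact ⟨0, by simpa using Ideal.subset_span hx⟩
  | algebraMap c => exact ⟨c, by simp⟩
  | add x y _ _ hx hy =>
    obtain ⟨⟨c, hc⟩, d, hd⟩ := And.intro hx hy
    exact ⟨c + d, by simpa only [map_add, add_sub_add_comm] using add_mem hc hd⟩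
  | mul x y _ _ hx hy =>
    obtain ⟨⟨c, hc⟩, d, hd⟩ := And.intro hx hy
    refine ⟨c * d, ?_⟩
    rw [map_mul, show x * y - algebraMap K R c * algebraMap K R d =
      y * (x - algebraMap K R c) + algebraMap K R c * (y - algebraMap K R d) by ring]
    exact add_mem (Ideal.mul_mem_left _ _ hc) (Ideal.mul_mem_left _ _ hd)

theorem isNilpotent_of_mem_span (hnil : ∀ x ∈ s, IsNilpotent x) {x : R} (hx : x ∈ Ideal.span s) :
    IsNilpotent x :=
  mem_nilradical.1 (Ideal.span_le.2 (fun y hy => mem_nilradical.2 (hnil y hy)) hx)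

theorem isUnit_or_mem_span (hs : Algebra.adjoin K s = ⊤) (hnil : ∀ x ∈ s, IsNilpotent x) (x : R) :
    IsUnit x ∨ x ∈ Ideal.span s := by
  obtain ⟨c, hc⟩ := exists_sub_algebraMap_mem_span hs x
  obtain rfl | hc0 := eq_or_ne c 0
  · exact .inr (by simpa using hc)
  · rw [← add_sub_cancel (algebraMap K R c) x]
    exact .inl ((isNilpotent_of_mem_span hnil hc).isUnit_add_left_of_commute
      (hc0.isUnit.map _) (.all _ _))

theorem isLocalRing_of_adjoin_eq_top [Nontrivial R] (hs : Algebra.adjoin K s = ⊤)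
    (hnil : ∀ x ∈ s, IsNilpotent x) : IsLocalRing R :=
  .of_isUnit_or_isUnit_one_sub_self fun x => (isUnit_or_mem_span hs hnil x).imp_right fun hx =>
    (isNilpotent_of_mem_span hnil hx).isUnit_one_sub

theorem span_eq_maximalIdeal [IsLocalRing R] (hs : Algebra.adjoin K s = ⊤)
    (hnil : ∀ x ∈ s, IsNilpotent x) : Ideal.span s = maximalIdeal R := by
  ext x
  exact ⟨fun hx hu => hu.not_isNilpotent (isNilpotent_of_mem_span hnil hx),
    (isUnit_or_mem_span hs hnil x).resolve_left⟩

end LocalOfNilpotentGenerators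

section MultiplicationAlgebra

universe u

variable {A : Type u} [NonUnitalNonAssocRing A] [Module ℂ A]

variable (A) in
/-- The span `A²` of the products. -/
def square : Submodule ℂ A := Submodule.span ℂ {x | ∃ y z : A, x = y * z}

theorem mul_mem_square (x y : A) : x * y ∈ square A := Submodule.subset_span ⟨x, y, rfl⟩

section

variable [SMulCommClass ℂ A A]

/-- Left multiplication by `a`, restricted to the square. -/
def leftMul (a : A) : Module.End ℂ (square A) :=
  (LinearMap.mulLeft ℂ a).restrict fun _ _ => mul_mem_square _ _

@[simp] theorem coe_leftMul (a : A) (u : square A) : (leftMul a u : A) = a * u := rfl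

theorem isNilpotent_leftMul (hnil : IsNilpotentAlgebra A) (a : A) : IsNilpotent (leftMul a) := by
  have hprod (k : ℕ) (u : square A) : IsProduct (k + 1) ((leftMul a ^ k) u : A) := by
    induction k with
    | zero => exact .of (u : A)
    | succ k ih =>
      rw [pow_succ', Module.End.mul_apply, coe_leftMul, add_comm]
      exact .mul (.of a) ih
  obtain ⟨n, hn, hzero⟩ := hnil
  refine ⟨n - 1, LinearMap.ext fun u => Subtype.ext (hzero _ ?_)⟩
  simpa only [Nat.sub_add_cancel hn] using hprod (n - 1) u

end

section

variable [IsScalarTower ℂ A A]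

/-- Right multiplication by `a`, restricted to the square. -/
def rightMul (a : A) : Module.End ℂ (square A) :=
  (LinearMap.mulRight ℂ a).restrict fun _ _ => mul_mem_square _ _

@[simp] theorem coe_rightMul (a : A) (u : square A) : (rightMul a u : A) = u * a := rfl

theorem isNilpotent_rightMul (hnil : IsNilpotentAlgebra A) (a : A) : IsNilpotent (rightMul a) := by
  have hprod (k : ℕ) (u : square A) : IsProduct (k + 1) ((rightMul a ^ k) u : A) := by
    induction k with
    | zero => exact .of (u : A)
    | succ k ih =>
      rw [pow_succ', Module.End.mul_apply, coe_rightMul]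
      exact .mul ih (.of a)
  obtain ⟨n, hn, hzero⟩ := hnil
  refine ⟨n - 1, LinearMap.ext fun u => Subtype.ext (hzero _ ?_)⟩
  simpa only [Nat.sub_add_cancel hn] using hprod (n - 1) u

end

variable [IsScalarTower ℂ A A] [SMulCommClass ℂ A A]

theorem IsBicommutative.mul_comm_of_mem_square (h : IsBicommutative A) {u v : A}
    (hu : u ∈ square A) (hv : v ∈ square A) : u * v = v * u := by
  induction hu, hv using Submodule.span_induction₂ with
  | mem_mem u v hu hv =>
    obtain ⟨⟨x, y, rfl⟩, z, w, rfl⟩ := And.intro hu hv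
    calc x * y * (z * w) = x * w * (z * y) := by rw [h.2 (x * y) z w, h.1 x y w, h.2 z (x * w) y]
      _ = z * w * (x * y) := by rw [h.1 x w (z * y), h.2 x z y, h.1 z (x * y) w]
  | zero_left => simp
  | zero_right => simp
  | add_left x y z _ _ _ hx hy => rw [add_mul, mul_add, hx, hy]
  | add_right x y z _ _ _ hx hy => rw [add_mul, mul_add, hx, hy]
  | smul_left c x y _ _ hx => rw [smul_mul_assoc, mul_smul_comm, hx]
  | smul_right c x y _ _ hx => rw [smul_mul_assoc, mul_smul_comm, hx]

theorem IsBicommutative.mul_assoc_of_mem_square (h : IsBicommutative A) (x y : A) {u : A}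
    (hu : u ∈ square A) : x * (u * y) = x * u * y := by
  induction hu using Submodule.span_induction with
  | mem u hu =>
    obtain ⟨a, b, rfl⟩ := hu
    rw [h.2 x (a * b) y, h.1 a b (x * y), h.2 a x y, h.1 x (a * y) b, h.2 x a b, h.1 a (x * b) y,
      h.mul_comm_of_mem_square (mul_mem_square _ _) (mul_mem_square _ _)]
  | zero => simp
  | add x y _ _ hx hy => rw [add_mul, mul_add, mul_add, add_mul, hx, hy]
  | smul c x _ hx => rw [smul_mul_assoc, mul_smul_comm, hx, mul_smul_comm, smul_mul_assoc]

theorem IsBicommutative.leftMul_mul_rightMul (h : IsBicommutative A) (x y : A) :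
    leftMul x * rightMul y = rightMul y * leftMul x :=
  LinearMap.ext fun u => Subtype.ext (h.mul_assoc_of_mem_square x y u.2)

/-- The algebra of operators on the square of `A` generated by left and right multiplication
by `a`. It plays the role of `Q` in `PairAlgebra`. -/
def multiplicationAlgebra (a : A) : Subalgebra ℂ (Module.End ℂ (square A)) :=
  Algebra.adjoin ℂ {leftMul a, rightMul a}

/-- Left multiplication by `a`, as an element of the multiplication algebra. -/
def leftOp (a : A) : multiplicationAlgebra a :=
  ⟨leftMul a, Algebra.subset_adjoin (Set.mem_insert _ _)⟩

/-- Right multiplication by `a`, as an element of the multiplication algebra. -/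
def rightOp (a : A) : multiplicationAlgebra a :=
  ⟨rightMul a, Algebra.subset_adjoin (Set.mem_insert_of_mem _ rfl)⟩

theorem adjoin_leftOp_rightOp (a : A) : Algebra.adjoin ℂ {leftOp a, rightOp a} = ⊤ := by
  refine (congrArg (Algebra.adjoin ℂ) ?_).trans
    (Algebra.adjoin_adjoin_coe_preimage (R := ℂ) (s := {leftMul a, rightMul a}))
  ext f
  exact or_congr Subtype.ext_iff Subtype.ext_iff

theorem isNilpotent_leftOp (hnil : IsNilpotentAlgebra A) (a : A) : IsNilpotent (leftOp a) :=
  (isNilpotent_leftMul hnil a).imp fun _ hn => Subtype.ext hn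

theorem isNilpotent_rightOp (hnil : IsNilpotentAlgebra A) (a : A) : IsNilpotent (rightOp a) :=
  (isNilpotent_rightMul hnil a).imp fun _ hn => Subtype.ext hn

/-- The square `a a` of an element, as an element of the square of the algebra. -/
def selfMul (a : A) : square A := ⟨a * a, mul_mem_square a a⟩

/-- The linear map `(c, f) ↦ c a + f (a a)`, which turns out to be an isomorphism from a
`PairAlgebra` if `a` generates `A`. -/
def ofPair (a : A) : ℂ × multiplicationAlgebra a →ₗ[ℂ] A :=
  (LinearMap.toSpanSingleton ℂ A a).coprod
    ((square A).subtype ∘ₗ LinearMap.applyₗ (selfMul a) ∘ₗ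
      (multiplicationAlgebra a).val.toLinearMap)

theorem ofPair_apply (a : A) (x : ℂ × multiplicationAlgebra a) :
    ofPair a x = x.1 • a + (x.2.1 (selfMul a) : A) := rfl

theorem ofPair_zero_mk (a : A) (f : multiplicationAlgebra a) :
    ofPair a (0, f) = (f.1 (selfMul a) : A) := by
  rw [ofPair_apply, zero_smul, zero_add]

theorem IsBicommutative.isMulCommutative_multiplicationAlgebra (h : IsBicommutative A) (a : A) :
    IsMulCommutative (multiplicationAlgebra a) := by
  refine Algebra.isMulCommutative_adjoin ℂ ?_
  rintro x (rfl | rfl) y (rfl | rfl)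
  · rfl
  · exact h.leftMul_mul_rightMul a a
  · exact (h.leftMul_mul_rightMul a a).symm
  · rfl

variable {a : A}

theorem IsBicommutative.commute (h : IsBicommutative A) (f g : multiplicationAlgebra a) :
    Commute f g :=
  (h.isMulCommutative_multiplicationAlgebra a).is_comm.comm f g

theorem IsBicommutative.apply_mul (h : IsBicommutative A) (f : multiplicationAlgebra a)
    (u v : square A) : (f.1 u : A) * v = f.1 ⟨u * v, mul_mem_square _ _⟩ := by
  obtain ⟨f, hf⟩ := f
  induction hf using Algebra.adjoin_induction generalizing u v with
  | mem f hf =>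
    obtain rfl | rfl := hf
    · rw [coe_leftMul, coe_leftMul, h.mul_comm_of_mem_square (mul_mem_square _ _) v.2, h.2 v a u,
        h.mul_comm_of_mem_square v.2 u.2]
    · exact h.1 u a v
  | algebraMap c => simp [Module.algebraMap_end_apply, smul_mul_assoc]
  | add f g _ _ hf hg => simp_all [add_mul]
  | mul f g _ _ hf hg =>
    exact (hf _ _).trans (congrArg (fun x => (f x : A)) (Subtype.ext (hg u v)))

theorem IsBicommutative.selfMul_mul (h : IsBicommutative A) (v : square A) :
    (selfMul a : A) * v = leftMul a (rightMul a v) :=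
  (h.mul_comm_of_mem_square (selfMul a).2 v.2).trans (h.2 v a a)

theorem IsBicommutative.ofPair_zero_mk_mul_ofPair_zero_mk (h : IsBicommutative A)
    (f g : multiplicationAlgebra a) :
    ofPair a (0, f) * ofPair a (0, g) = ofPair a (0, rightOp a * f * (leftOp a * g)) := by
  have hcomm : rightOp a * f * (leftOp a * g) = f * (leftOp a * (rightOp a * g)) := by
    rw [(h.commute (rightOp a) f).eq, mul_assoc, (h.commute (rightOp a) _).eq, mul_assoc,
      (h.commute g _).eq]
  rw [hcomm, ofPair_zero_mk, ofPair_zero_mk, ofPair_zero_mk, h.apply_mul]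
  exact congrArg (fun x => (f.1 x : A)) (Subtype.ext (h.selfMul_mul _))

theorem IsBicommutative.ofPair_mul_ofPair (h : IsBicommutative A)
    (x y : ℂ × multiplicationAlgebra a) : ofPair a x * ofPair a y =
      ofPair a (0, (algebraMap ℂ _ x.1 + rightOp a * x.2) *
        (algebraMap ℂ _ y.1 + leftOp a * y.2)) := by
  obtain ⟨c, f⟩ := x
  obtain ⟨d, g⟩ := y
  have hself : a * a = ofPair a (0, 1) := (ofPair_zero_mk a 1).symm
  have hleft : a * ofPair a (0, g) = ofPair a (0, leftOp a * g) := by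
    rw [ofPair_zero_mk, ofPair_zero_mk]; rfl
  have hright : ofPair a (0, f) * a = ofPair a (0, rightOp a * f) := by
    rw [ofPair_zero_mk, ofPair_zero_mk]; rfl
  have hsplit (c : ℂ) (f : multiplicationAlgebra a) :
      ofPair a (c, f) = c • a + ofPair a (0, f) := by
    rw [ofPair_zero_mk]; rfl
  rw [hsplit c f, hsplit d g]
  simp only [add_mul, mul_add, smul_mul_assoc, mul_smul_comm, hself, hleft, hright,
    h.ofPair_zero_mk_mul_ofPair_zero_mk, ← map_smul, ← map_add, Algebra.algebraMap_eq_smul_one]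
  congr 1
  ext <;> simp

section Generator

variable (ha : NonUnitalAlgebra.adjoin ℂ {a} = ⊤)
include ha

theorem IsBicommutative.ofPair_surjective (h : IsBicommutative A) :
    Function.Surjective (ofPair a) := by
  intro x
  have hx : x ∈ NonUnitalAlgebra.adjoin ℂ {a} := ha ▸ NonUnitalAlgebra.mem_top
  induction hx using NonUnitalAlgebra.adjoin_induction with
  | mem x hx => exact ⟨(1, 0), by simpa [ofPair_apply] using hx.symm⟩
  | add x y _ _ hx hy =>
    obtain ⟨⟨x, rfl⟩, y, rfl⟩ := And.intro hx hy
    exact ⟨x + y, map_add _ x y⟩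
  | zero => exact ⟨0, map_zero _⟩
  | mul x y _ _ hx hy =>
    obtain ⟨⟨x, rfl⟩, y, rfl⟩ := And.intro hx hy
    exact ⟨_, (h.ofPair_mul_ofPair x y).symm⟩
  | smul c x _ hx =>
    obtain ⟨x, rfl⟩ := hx
    exact ⟨c • x, map_smul _ c x⟩

theorem IsBicommutative.exists_ofPair_zero_mk_eq (h : IsBicommutative A) {u : A}
    (hu : u ∈ square A) : ∃ f, ofPair a (0, f) = u := by
  suffices hle : square A ≤ LinearMap.range (ofPair a ∘ₗ LinearMap.inr ℂ ℂ _) from hle hu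
  refine Submodule.span_le.2 ?_
  rintro _ ⟨x, y, rfl⟩
  obtain ⟨⟨x, rfl⟩, y, rfl⟩ := And.intro (h.ofPair_surjective ha x) (h.ofPair_surjective ha y)
  exact ⟨_, (h.ofPair_mul_ofPair x y).symm⟩

theorem IsBicommutative.ofPair_zero_mk_injective (h : IsBicommutative A) :
    Function.Injective fun f => ofPair a (0, f) := by
  intro f g hfg
  have hself : f.1 (selfMul a) = g.1 (selfMul a) :=
    Subtype.ext ((ofPair_zero_mk a f).symm.trans (hfg.trans (ofPair_zero_mk a g)))
  refine Subtype.ext (LinearMap.ext fun u => ?_)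
  obtain ⟨k, hk⟩ := h.exists_ofPair_zero_mk_eq ha u.2
  obtain rfl : k.1 (selfMul a) = u := Subtype.ext ((ofPair_zero_mk a k).symm.trans hk)
  have hcomm (f : multiplicationAlgebra a) : f.1 (k.1 (selfMul a)) = k.1 (f.1 (selfMul a)) :=
    congrArg (fun q : multiplicationAlgebra a => q.1 (selfMul a)) (h.commute f k).eq
  rw [hcomm f, hcomm g, hself]

theorem IsBicommutative.nontrivial_multiplicationAlgebra (h : IsBicommutative A)
    (hdim : 1 < Module.finrank ℂ A) : Nontrivial (multiplicationAlgebra a) := by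
  by_contra hQ
  rw [not_nontrivial_iff_subsingleton] at hQ
  refine hdim.not_ge (finrank_le_one a fun x => ?_)
  obtain ⟨⟨c, f⟩, rfl⟩ := h.ofPair_surjective ha x
  rw [Subsingleton.elim f 0, ofPair_apply]
  exact ⟨c, (add_zero _).symm⟩

variable [Nontrivial (multiplicationAlgebra a)]

theorem IsBicommutative.notMem_square (h : IsBicommutative A) (hnil : IsNilpotentAlgebra A) :
    a ∉ square A := by
  intro hmem
  obtain ⟨f, hfa⟩ := h.exists_ofPair_zero_mk_eq ha hmem
  have hone : rightOp a * f * (leftOp a * f) = 1 := by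
    refine h.ofPair_zero_mk_injective ha ?_
    calc ofPair a (0, rightOp a * f * (leftOp a * f)) = ofPair a (0, f) * ofPair a (0, f) :=
          (h.ofPair_zero_mk_mul_ofPair_zero_mk f f).symm
      _ = ofPair a (0, 1) := by rw [hfa, ofPair_zero_mk]; rfl
  have hnilp : IsNilpotent (rightOp a * f * (leftOp a * f)) :=
    (h.commute _ _).isNilpotent_mul_left <|
      (h.commute _ _).isNilpotent_mul_right (isNilpotent_leftOp hnil a)
  exact not_isNilpotent_one (hone ▸ hnilp)

theorem IsBicommutative.ofPair_injective (h : IsBicommutative A) (hnil : IsNilpotentAlgebra A) :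
    Function.Injective (ofPair a) := by
  refine (injective_iff_map_eq_zero _).2 fun ⟨c, f⟩ hcf => ?_
  obtain rfl : c = 0 := by
    by_contra hc
    refine h.notMem_square ha hnil (((square A).smul_mem_iff hc).1 ?_)
    rw [eq_neg_of_add_eq_zero_left ((ofPair_apply a (c, f)).symm.trans hcf)]
    exact neg_mem (f.1 (selfMul a)).2
  rw [h.ofPair_zero_mk_injective ha (hcf.trans (map_zero (ofPair a)).symm), Prod.mk_zero_zero]

end Generator

open scoped IsMulCommutative in
theorem IsBicommutative.exists_isomorphic_pairAlgebra (h : IsBicommutative A)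
    (hnil : IsNilpotentAlgebra A) (hgen : IsOneGenerated A) (hdim : 1 < Module.finrank ℂ A) :
    ∃ (Q : Type u) (_ : CommRing Q) (_ : IsLocalRing Q) (_ : Algebra ℂ Q) (_ : Module.Finite ℂ Q)
      (l r : Q), Ideal.span {l, r} = IsLocalRing.maximalIdeal Q ∧
        Isomorphic A (PairAlgebra l r) := by
  obtain ⟨a, ha⟩ := hgen
  have := h.isMulCommutative_multiplicationAlgebra a
  have := h.nontrivial_multiplicationAlgebra ha hdim
  have : Module.Finite ℂ A := FiniteDimensional.of_finrank_pos (by omega)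
  have hnilp (x : multiplicationAlgebra a) (hx : x ∈ ({leftOp a, rightOp a} : Set _)) :
      IsNilpotent x := by
    obtain rfl | rfl := hx
    exacts [isNilpotent_leftOp hnil a, isNilpotent_rightOp hnil a]
  have hadj := adjoin_leftOp_rightOp a
  have := isLocalRing_of_adjoin_eq_top (R := multiplicationAlgebra a) hadj hnilp
  let e : PairAlgebra (leftOp a) (rightOp a) ≃ₗ[ℂ] A :=
    LinearEquiv.ofBijective (ofPair a) ⟨h.ofPair_injective ha hnil, h.ofPair_surjective ha⟩
  refine ⟨multiplicationAlgebra a, inferInstance, inferInstance, inferInstance, inferInstance,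
    leftOp a, rightOp a, span_eq_maximalIdeal hadj hnilp, ?_⟩
  exact .symm ⟨e, fun x y => (h.ofPair_mul_ofPair x y).symm⟩

end MultiplicationAlgebra

end Bicomm

theorem theoremB {A : Type*} [NonUnitalNonAssocRing A] [Module ℂ A]
    [IsScalarTower ℂ A A] [SMulCommClass ℂ A A]
    (hdim : Module.finrank ℂ A = 6)
    (hbicomm : Bicomm.IsBicommutative A)
    (hnil : Bicomm.IsNilpotentAlgebra A)
    (hgen : Bicomm.IsOneGenerated A) :
    ∃ T : Bicomm.Table, Bicomm.IsListed T ∧ Bicomm.Isomorphic A (Bicomm.TableAlgebra T) := by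
  obtain ⟨Q, _, _, _, _, l, r, hM, hiso⟩ :=
    hbicomm.exists_isomorphic_pairAlgebra hnil hgen (by omega)
  have hQ : Module.finrank ℂ Q + 1 = 6 := by
    obtain ⟨f, -⟩ := hiso
    rw [← hdim, f.finrank_eq, Bicomm.PairAlgebra.finrank_eq_add_one]
  exact (Bicomm.hasListedTable_pairAlgebra (by omega) hM).of_isomorphic hiso
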